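/- **Conventions.** A commutative differential ring $(R,\partial)$ is a commutative ring with an additive map $\partial$ satisfying the Leibniz rule; its ring of constants is $\ker\partial$. A commutative *integro-differential ring* $(S,\partial,\int)$ is a commutative differential ring with a map $\int:S\to S$ that is linear over the constants of $S$ and satisfies $\partial\int=\mathrm{id}$. A commutative *quasi-integro-differential ring* $(R,\partial,Q)$ is a commutative differential ring with a map $Q:R\to R$ that is linear over the constants of $R$ and satisfies $\partial Q\partial=\partial$ and $Q\partial Q=Q$. Homomorphisms of differential (integro-differential) rings are unital ring homomorphisms commuting with $\partial$ (with $\partial$ and $\int$). **Construction.** Let $(R,\partial,Q)$ be a commutative quasi-integro-differential ring with constants $C$. All tensor products and symmetric algebras are taken over $C$. Put $R_J:=Q R$, $R_T:=\ker Q$, $T:=\bigoplus_{n\ge0}R_T^{\otimes n}$, $\widetilde T:=\bigoplus_{n\ge1}R_T^{\otimes n}$, and write $\mathbin{\sqcup\!\sqcup}$ for the shuffle product on $T$. For $f=f_1\otimes\dots\otimes f_n$ put $f_i^j:=f_i\otimes\dots\otimes f_j$, with $f_{j+1}^{j}:=1_T$ the empty tensor. Let $\widetilde T\odot\widetilde T$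 be the quotient of $\widetilde T\otimes\widetilde T$ by the span of all $x\otimes y-y\otimes x$, let $\varepsilon$ denote isomorphisms of $R_J\otimes\widetilde T$ and of $\widetilde T\odot\widetilde T$ onto copies of these modules, and put $$\widetilde C_1:=\mathrm{Sym}(\varepsilon(R_J\otimes\widetilde T)),\qquad C_2:=\mathrm{Sym}(\varepsilon(\widetilde T\odot\widetilde T))/J_2,$$ where $J_2$ is the ideal generated by the elements $$\varepsilon((f\mathbin{\sqcup\!\sqcup}g)\odot h)-\varepsilon(f\odot(g\mathbin{\sqcup\!\sqcup}h))+\sum_{j=0}^{m-1}\Big(\sum_{i=\max(0,1-j)}^{n-1}\varepsilon(f_{i+1}^n\odot g_{j+1}^m)\,\varepsilon((f_1^i\mathbin{\sqcup\!\sqcup}g_1^j)\odot h)-\sum_{k=\max(0,1-j)}^{l-1}\varepsilon(f\odot(g_1^j\mathbin{\sqcup\!\sqcup}h_1^k))\,\varepsilon(g_{j+1}^m\odot h_{k+1}^l)\Big)$$ for all $n,m,l\ge1$ and all pure tensors $f\in R_T^{\otimes n}$, $g\in R_T^{\otimes m}$, $h\in R_T^{\otimes l}$. The module $C_2\otimes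 T$ is a commutative $C$-algebra under the $C$-bilinear product determined, for $c,d\in C_2$ and pure tensors $f\in R_T^{\otimes n}$, $g\in R_T^{\otimes m}$ ($n,m\ge0$), by $$(c\otimes f)\cdot(d\otimes g)=cd\otimes(f\mathbin{\sqcup\!\sqcup}g)+\sum_{i=0}^{n-1}\sum_{j=0}^{m-1}\big(cd\,\varepsilon(f_{i+1}^n\odot g_{j+1}^m)\big)\otimes(f_1^i\mathbin{\sqcup\!\sqcup}g_1^j).$$ Let $\mathrm{IDR}_Q(R):=R\otimes\widetilde C_1\otimes(C_2\otimes T)$ be the tensor product of commutative $C$-algebras. It is a commutative integro-differential ring with the $C$-linear maps $\partial$ and $\int$ determined, for $f_0\in R$, $c=c_1\otimes c_2$ with $c_1\in\widetilde C_1$, $c_2\in C_2$, and a pure tensor $f\in R_T^{\otimes n}$, by $$\partial(f_0\otimes c\otimes f)=\begin{cases}(\partial f_0)\otimes c\otimes f & n=0\\ (\partial f_0)\otimes c\otimes f+(f_0f_1)\otimes c\otimes f_2^n & n>0,\end{cases}$$ $$\textstyle\int(f_0\otimes c\otimes f)=\begin{cases}(Qf_0)\otimes c\otimes f+1\otimes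 c\otimes((f_0-\partial Qf_0)\otimes f) & n=0\\ (Qf_0)\otimes c\otimes f-1\otimes(c_1\,\varepsilon((Qf_0)\otimes f))\otimes c_2\otimes1_T\\ \quad-\int(((Qf_0)f_1)\otimes c\otimes f_2^n)+1\otimes c\otimes((f_0-\partial Qf_0)\otimes f) & n>0.\end{cases}$$ Let $\iota:R\to\mathrm{IDR}_Q(R)$ be the ring homomorphism $\iota(f)=f\otimes1\otimes1\otimes1_T$. **Statement.** Let $(R,\partial,Q)$ be a commutative quasi-integro-differential ring, let $(S,\partial,\int)$ be a commutative integro-differential ring, and let $\varphi:R\to S$ be a differential ring homomorphism such that $\varphi(Q\partial f)=\int\partial\varphi(f)$ for all $f\in R$. Then there exists a unique integro-differential ring homomorphism $\eta:\mathrm{IDR}_Q(R)\to S$ such that $\eta(\iota(f))=\varphi(f)$ for all $f\in R$. -/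

import Mathlib

open scoped TensorProduct Differential

noncomputable section

namespace Shuffle

variable (C : Type*) [CommRing C] (M : Type*) [AddCommGroup M] [Module C M]

/-- The pure tensor `f₁ ⊗ ⋯ ⊗ fₙ` in the tensor algebra. -/
def pureTensor (f : List M) : TensorAlgebra C M := (f.map (TensorAlgebra.ι C)).prod

variable {C M}

@[simp] lemma pureTensor_nil : pureTensor C M [] = 1 := rfl

@[simp] lemma pureTensor_cons (a : M) (f : List M) :
    pureTensor C M (a :: f) = TensorAlgebra.ι C a * pureTensor C M f := by simp [pureTensor]

lemma pureTensor_append (f g : List M) : pureTensor C M (f ++ g) = pureTensor C M f * pureTensor C M g := by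
  simp [pureTensor]

lemma span_pure : Submodule.span C (Set.range (pureTensor C M)) = ⊤ := by
  have hmul : ∀ x y, x ∈ Submodule.span C (Set.range (pureTensor C M)) →
      y ∈ Submodule.span C (Set.range (pureTensor C M)) →
      x * y ∈ Submodule.span C (Set.range (pureTensor C M)) := by
    intro x y hx hy
    have := Submodule.mul_mem_mul hx hy
    rw [Submodule.span_mul_span] at this
    refine Submodule.span_mono ?_ this
    rintro _ ⟨_, ⟨f, rfl⟩, _, ⟨g, rfl⟩, rfl⟩
    exact ⟨f ++ g, pureTensor_append f g⟩
  rw [eq_top_iff]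
  rintro t -
  induction t using TensorAlgebra.induction with
  | algebraMap r =>
    rw [Algebra.algebraMap_eq_smul_one]
    exact Submodule.smul_mem _ _ (Submodule.subset_span ⟨[], rfl⟩)
  | ι x => exact Submodule.subset_span ⟨[x], by simp [pureTensor]⟩
  | mul x y hx hy => exact hmul x y hx hy
  | add x y hx hy => exact Submodule.add_mem _ hx hy

@[elab_as_elim]
lemma pure_induction {p : TensorAlgebra C M → Prop} (t : TensorAlgebra C M)
    (pure : ∀ f, p (pureTensor C M f)) (add : ∀ x y, p x → p y → p (x + y))
    (smul : ∀ (c : C) x, p x → p (c • x)) : p t := by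
  have ht : t ∈ Submodule.span C (Set.range (Shuffle.pureTensor C M)) := by simp [span_pure]
  induction ht using Submodule.span_induction with
  | mem x h => obtain ⟨f, rfl⟩ := h; exact pure f
  | zero => simpa using smul 0 _ (pure [])
  | add x y _ _ hx hy => exact add _ _ hx hy
  | smul a x _ hx => exact smul _ _ hx

@[elab_as_elim]
lemma cons_induction {p : TensorAlgebra C M → Prop} (t : TensorAlgebra C M)
    (one : p 1) (cons : ∀ a t, p t → p (TensorAlgebra.ι C a * t))
    (add : ∀ x y, p x → p y → p (x + y))
    (smul : ∀ (c : C) x, p x → p (c • x)) : p t := by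
  induction t using pure_induction with
  | pure f =>
    induction f with
    | nil => simpa using one
    | cons a f ih => simpa using cons a _ ih
  | add x y hx hy => exact add _ _ hx hy
  | smul c x hx => exact smul _ _ hx

variable {N : Type*} [AddCommGroup N] [Module C N]

/-- The linear map `F` on `T(M)` with `F 1 = n₀` and `F (a ⊗ t) = g a (t, F t)`. -/
def primRec (n₀ : N) (g : M →ₗ[C] (TensorAlgebra C M × N) →ₗ[C] N) :
    TensorAlgebra C M →ₗ[C] N :=
  LinearMap.snd C (TensorAlgebra C M) N ∘ₗ
    LinearMap.applyₗ ((1 : TensorAlgebra C M), n₀) ∘ₗ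
      (TensorAlgebra.lift C
        (LinearMap.mk₂ C (fun (a : M) (p : TensorAlgebra C M × N) =>
            (TensorAlgebra.ι C a * p.1, g a p))
          (by intros; simp [add_mul]) (by intros; simp)
          (by intros; simp [mul_add]) (by intros; simp) :
        M →ₗ[C] Module.End C (TensorAlgebra C M × N))).toLinearMap

@[simp] lemma primRec_one (n₀ : N) (g : M →ₗ[C] (TensorAlgebra C M × N) →ₗ[C] N) :
    primRec n₀ g 1 = n₀ := by
  simp [primRec]

@[simp] lemma primRec_cons (n₀ : N) (g : M →ₗ[C] (TensorAlgebra C M × N) →ₗ[C] N) (a : M)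
    (t : TensorAlgebra C M) :
    primRec n₀ g (TensorAlgebra.ι C a * t) = g a (t, primRec n₀ g t) := by
  set φ := TensorAlgebra.lift C
        (LinearMap.mk₂ C (fun (a : M) (p : TensorAlgebra C M × N) =>
            (TensorAlgebra.ι C a * p.1, g a p))
          (by intros; simp [add_mul]) (by intros; simp)
          (by intros; simp [mul_add]) (by intros; simp) :
        M →ₗ[C] Module.End C (TensorAlgebra C M × N)) with hφ
  have hs (a : M) (p) : φ (TensorAlgebra.ι C a) p = (TensorAlgebra.ι C a * p.1, g a p) := by
    simp [hφ]
  have h (t) : primRec n₀ g t = (φ t (1, n₀)).2 := rfl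
  have h1 : ∀ t, (φ t (1, n₀)).1 = t := by
    intro t
    induction t using cons_induction with
    | one => simp
    | cons a t ih => rw [map_mul, Module.End.mul_apply, hs, ih]
    | add x y hx hy => simp [hx, hy]
    | smul c x hx => simp [hx]
  have h2 : φ t (1, n₀) = (t, primRec n₀ g t) := Prod.ext (h1 t) rfl
  rw [h, map_mul, Module.End.mul_apply, h2, hs]


/-- Deconcatenation: `f₁ ⊗ ⋯ ⊗ fₙ` is sent to the sum over `0 ≤ i ≤ n` of the tensors
`(fᵢ₊₁ ⊗ ⋯ ⊗ fₙ) ⊗ (f₁ ⊗ ⋯ ⊗ fᵢ)` (the suffix is the left factor). -/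
def decon : TensorAlgebra C M →ₗ[C] TensorAlgebra C M ⊗[C] TensorAlgebra C M :=
  primRec (1 ⊗ₜ 1)
    (LinearMap.mk₂ C (fun a p => (TensorAlgebra.ι C a * p.1) ⊗ₜ[C] 1 +
        (LinearMap.mulLeft C (TensorAlgebra.ι C a)).lTensor (TensorAlgebra C M) p.2)
      (by
        intro a b p
        have : LinearMap.mulLeft C (TensorAlgebra.ι C (a + b)) =
          LinearMap.mulLeft C (TensorAlgebra.ι C a) + LinearMap.mulLeft C (TensorAlgebra.ι C b) := by
          ext; simp [add_mul]
        rw [this]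
        simp only [map_add, add_mul, TensorProduct.add_tmul, LinearMap.lTensor_add,
          LinearMap.add_apply]
        abel)
      (by
        intro c a p
        have : LinearMap.mulLeft C (TensorAlgebra.ι C (c • a)) =
          c • LinearMap.mulLeft C (TensorAlgebra.ι C a) := by
          ext; simp
        rw [this]
        simp [TensorProduct.smul_tmul', LinearMap.lTensor_smul])
      (by intros; simp only [Prod.fst_add, Prod.snd_add, mul_add, TensorProduct.add_tmul, map_add]
          abel)
      (by intros; simp [TensorProduct.smul_tmul']))

@[simp] lemma decon_one : decon (1 : TensorAlgebra C M) = 1 ⊗ₜ 1 := by simp [decon]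

/-- Prepend a letter to the right factor (the prefix). -/
def prep (a : M) : TensorAlgebra C M ⊗[C] TensorAlgebra C M →ₗ[C]
    TensorAlgebra C M ⊗[C] TensorAlgebra C M :=
  (LinearMap.mulLeft C (TensorAlgebra.ι C a)).lTensor (TensorAlgebra C M)

@[simp] lemma prep_tmul (a : M) (x y : TensorAlgebra C M) :
    prep a (x ⊗ₜ[C] y) = x ⊗ₜ (TensorAlgebra.ι C a * y) := by simp [prep]

lemma decon_cons (a : M) (t : TensorAlgebra C M) :
    decon (TensorAlgebra.ι C a * t) = (TensorAlgebra.ι C a * t) ⊗ₜ 1 + prep a (decon t) := by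
  simp [decon, prep]

lemma decon_pureTensor (f : List M) :
    decon (pureTensor C M f) =
      ∑ i ∈ Finset.range (f.length + 1),
        pureTensor C M (f.drop i) ⊗ₜ[C] pureTensor C M (f.take i) := by
  induction f with
  | nil => simp
  | cons a f ih =>
    rw [pureTensor_cons, decon_cons, ih, List.length_cons, Finset.sum_range_succ' _ (f.length + 1), map_sum,
      add_comm]
    simp

/-- The map `Y ↦ (s ↦ ∑ᵢ s₁ⁱ ⊗ Y(sᵢ₊₁ⁿ))`. -/
def spread : (TensorAlgebra C M →ₗ[C] TensorAlgebra C M) →ₗ[C]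
    (TensorAlgebra C M →ₗ[C] TensorAlgebra C M) where
  toFun Y := TensorProduct.lift (LinearMap.mul C (TensorAlgebra C M)).flip ∘ₗ
    Y.rTensor (TensorAlgebra C M) ∘ₗ decon
  map_add' X Y := by
    rw [LinearMap.rTensor_add, LinearMap.add_comp, LinearMap.comp_add]
  map_smul' c Y := by
    rw [LinearMap.rTensor_smul, LinearMap.smul_comp, LinearMap.comp_smul, RingHom.id_apply]

lemma spread_one (Y : TensorAlgebra C M →ₗ[C] TensorAlgebra C M) : spread Y 1 = Y 1 := by
  simp [spread]

lemma spread_cons (Y : TensorAlgebra C M →ₗ[C] TensorAlgebra C M) (b : M) (s : TensorAlgebra C M) :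
    spread Y (TensorAlgebra.ι C b * s) =
      Y (TensorAlgebra.ι C b * s) + TensorAlgebra.ι C b * spread Y s := by
  simp only [spread, LinearMap.coe_mk, AddHom.coe_mk, LinearMap.comp_apply, decon_cons, map_add]
  congr 1
  · simp
  · generalize decon s = d
    induction d with
    | zero => simp
    | tmul x y => simp [mul_assoc]
    | add x y hx hy => simp [hx, hy, mul_add]

/-- The shuffle product on the tensor module `T(M)`. -/
def shuffle : TensorAlgebra C M →ₗ[C] TensorAlgebra C M →ₗ[C] TensorAlgebra C M :=
  primRec LinearMap.id
    (LinearMap.mk₂ C (fun a p => spread (LinearMap.mulLeft C (TensorAlgebra.ι C a) ∘ₗ p.2))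
      (by
        intro a b p
        rw [← map_add]; congr 1; ext; simp [add_mul])
      (by
        intro c a p
        rw [← map_smul]; congr 1; ext; simp)
      (by intros; simp [LinearMap.comp_add])
      (by intros; simp [LinearMap.comp_smul]))

@[simp] lemma one_shuffle (s : TensorAlgebra C M) : shuffle 1 s = s := by simp [shuffle]

lemma shuffle_cons_left (a : M) (t : TensorAlgebra C M) :
    shuffle (TensorAlgebra.ι C a * t) =
      spread (LinearMap.mulLeft C (TensorAlgebra.ι C a) ∘ₗ shuffle t) := by
  simp [shuffle]

@[simp] lemma shuffle_one (t : TensorAlgebra C M) : shuffle t 1 = t := by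
  induction t using cons_induction with
  | one => simp
  | cons a t ih => simp [shuffle_cons_left, spread_one, ih]
  | add x y hx hy => simp [hx, hy]
  | smul c x hx => simp [hx]

/-- The defining recursion of the shuffle product. -/
lemma shuffle_cons_cons (a b : M) (t s : TensorAlgebra C M) :
    shuffle (TensorAlgebra.ι C a * t) (TensorAlgebra.ι C b * s) =
      TensorAlgebra.ι C a * shuffle t (TensorAlgebra.ι C b * s) +
        TensorAlgebra.ι C b * shuffle (TensorAlgebra.ι C a * t) s := by
  rw [shuffle_cons_left, spread_cons]
  simp

lemma shuffle_comm (t s : TensorAlgebra C M) : shuffle t s = shuffle s t := by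
  induction t using cons_induction generalizing s with
  | one => simp
  | cons a t iht =>
    induction s using cons_induction with
    | one => simp
    | cons b s ihs => rw [shuffle_cons_cons, shuffle_cons_cons, iht, ihs, add_comm]
    | add x y hx hy => simp [hx, hy]
    | smul c x hx => simp [hx]
  | add x y hx hy => simp [hx, hy]
  | smul c x hx => simp [hx]


variable (C M) in
/-- The submodule `⨁_{n ≥ 1} M^{⊗ n}` of `T(M)`, i.e. the kernel of the projection of `T(M)` onto
its degree zero part `C`. -/
def posPart : Submodule C (TensorAlgebra C M) :=
  LinearMap.ker (TensorAlgebra.algebraMapInv (R := C) (M := M)).toLinearMap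

lemma mem_posPart {t : TensorAlgebra C M} :
    t ∈ posPart C M ↔ TensorAlgebra.algebraMapInv t = 0 := LinearMap.mem_ker

lemma sub_mem_posPart (t : TensorAlgebra C M) :
    (LinearMap.id - Algebra.linearMap C (TensorAlgebra C M) ∘ₗ
      (TensorAlgebra.algebraMapInv (R := C) (M := M)).toLinearMap : _ →ₗ[C] _) t ∈ posPart C M := by
  rw [mem_posPart]
  simp [TensorAlgebra.algebraMap_leftInverse M _]

variable (C M) in
/-- The projection of `T(M) = C ⊕ ⨁_{n ≥ 1} M^{⊗ n}` onto its second summand. -/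
def posProj : TensorAlgebra C M →ₗ[C] posPart C M :=
  LinearMap.codRestrict (posPart C M)
    (LinearMap.id - Algebra.linearMap C (TensorAlgebra C M) ∘ₗ
      (TensorAlgebra.algebraMapInv (R := C) (M := M)).toLinearMap) sub_mem_posPart

@[simp] lemma aug_cons (a : M) (t : TensorAlgebra C M) :
    TensorAlgebra.algebraMapInv (TensorAlgebra.ι C a * t) = 0 := by
  simp [TensorAlgebra.algebraMapInv]

lemma coe_posProj (t : TensorAlgebra C M) :
    (posProj C M t : TensorAlgebra C M) =
      t - algebraMap C _ (TensorAlgebra.algebraMapInv t) := rfl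

@[simp] lemma posProj_one : posProj C M 1 = 0 := by
  apply Subtype.ext
  rw [coe_posProj]
  simp

/-- `posProj` is the identity on `⨁_{n ≥ 1} M^{⊗ n}`. -/
lemma posProj_coe (t : posPart C M) : posProj C M t = t := by
  apply Subtype.ext
  rw [coe_posProj, mem_posPart.1 t.2]
  simp

lemma pureTensor_mem_posPart {f : List M} (hf : f ≠ []) : pureTensor C M f ∈ posPart C M := by
  cases f with
  | nil => exact absurd rfl hf
  | cons a f => simp [mem_posPart]

end Shuffle

/-- The symmetric product `P ⊙ P` of a module with itself. -/
def SymSquare (C : Type*) [CommRing C] (P : Type*) [AddCommGroup P] [Module C P] : Type _ :=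
  (P ⊗[C] P) ⧸ Submodule.span C {z : P ⊗[C] P | ∃ x y : P, z = x ⊗ₜ y - y ⊗ₜ x}

namespace SymSquare

variable (C : Type*) [CommRing C] (P : Type*) [AddCommGroup P] [Module C P]

instance : AddCommGroup (SymSquare C P) :=
  inferInstanceAs (AddCommGroup
    ((P ⊗[C] P) ⧸ Submodule.span C {z : P ⊗[C] P | ∃ x y : P, z = x ⊗ₜ y - y ⊗ₜ x}))

instance : Module C (SymSquare C P) :=
  inferInstanceAs (Module C
    ((P ⊗[C] P) ⧸ Submodule.span C {z : P ⊗[C] P | ∃ x y : P, z = x ⊗ₜ y - y ⊗ₜ x}))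

/-- The bilinear map `(x, y) ↦ x ⊙ y`. -/
def mk : P →ₗ[C] P →ₗ[C] SymSquare C P :=
  TensorProduct.curry
    (Submodule.mkQ (Submodule.span C {z : P ⊗[C] P | ∃ x y : P, z = x ⊗ₜ y - y ⊗ₜ x}))

variable {C P}

lemma mk_comm (x y : P) : mk C P x y = mk C P y x := by
  refine (Submodule.Quotient.eq _).2 ?_
  exact Submodule.subset_span ⟨x, y, rfl⟩

end SymSquare

namespace Shuffle

variable (C : Type*) [CommRing C] (M : Type*) [AddCommGroup M] [Module C M]

/-- The symmetric algebra on `ε(T̃ ⊙ T̃)`, where `T̃ = ⨁_{n ≥ 1} M^{⊗ n}`. -/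
abbrev SymC2 : Type _ := SymmetricAlgebra C (SymSquare C (posPart C M))

/-- The generator `ε(x ⊙ y)`; elements of `T(M)` are first projected to `T̃`, which does nothing
if `x` and `y` already lie in `T̃`. -/
def epsSym : TensorAlgebra C M →ₗ[C] TensorAlgebra C M →ₗ[C] SymC2 C M :=
  ((SymSquare.mk C (posPart C M)).compl₁₂ (posProj C M) (posProj C M)).compr₂
    (SymmetricAlgebra.ι C (SymSquare C (posPart C M)))

/-- The relation among evaluations of products of nested integrals that is attached to three pure
tensors `f`, `g`, `h`. Here `f.take i` is `f₁ ⊗ ⋯ ⊗ fᵢ` and `f.drop i` is `fᵢ₊₁ ⊗ ⋯ ⊗ fₙ`, and the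
truncated difference `1 - j` is `max (0, 1 - j)`. -/
def constRel (f g h : List M) : SymC2 C M :=
  epsSym C M (shuffle (pureTensor C M f) (pureTensor C M g)) (pureTensor C M h) -
    epsSym C M (pureTensor C M f) (shuffle (pureTensor C M g) (pureTensor C M h)) +
    ∑ j ∈ Finset.range g.length,
      ((∑ i ∈ Finset.Ico (1 - j) f.length,
          epsSym C M (pureTensor C M (f.drop i)) (pureTensor C M (g.drop j)) *
            epsSym C M (shuffle (pureTensor C M (f.take i)) (pureTensor C M (g.take j)))
              (pureTensor C M h)) -
        ∑ k ∈ Finset.Ico (1 - j) h.length,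
          epsSym C M (pureTensor C M f)
              (shuffle (pureTensor C M (g.take j)) (pureTensor C M (h.take k))) *
            epsSym C M (pureTensor C M (g.drop j)) (pureTensor C M (h.drop k)))

/-- The ideal generated by the relations `constRel` for pure tensors of positive length. -/
def constIdeal : Ideal (SymC2 C M) :=
  Ideal.span {r | ∃ f g h : List M, f ≠ [] ∧ g ≠ [] ∧ h ≠ [] ∧ r = constRel C M f g h}

/-- The algebra `C₂` of constants arising from evaluations of products of nested integrals. -/
def C2 : Type _ := SymC2 C M ⧸ constIdeal C M

instance : CommRing (C2 C M) := inferInstanceAs (CommRing (SymC2 C M ⧸ constIdeal C M))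

instance : Algebra C (C2 C M) := inferInstanceAs (Algebra C (SymC2 C M ⧸ constIdeal C M))

/-- The quotient map `Sym(ε(T̃ ⊙ T̃)) → C₂`. -/
def toC2 : SymC2 C M →ₐ[C] C2 C M := Ideal.Quotient.mkₐ C (constIdeal C M)

/-- The class of `ε(x ⊙ y)` in `C₂`. -/
def eps : TensorAlgebra C M →ₗ[C] TensorAlgebra C M →ₗ[C] C2 C M :=
  (epsSym C M).compr₂ (toC2 C M).toLinearMap

/-- The bilinear extension of `ε(x ⊙ y)` from `T̃` to `T(M) = C ⊕ T̃` that takes the value `1` at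
`(1, 1)` and vanishes on `C × T̃` and `T̃ × C`. -/
def epsExt : TensorAlgebra C M →ₗ[C] TensorAlgebra C M →ₗ[C] C2 C M :=
  eps C M +
    (LinearMap.mul C (C2 C M)).compl₁₂
      (Algebra.linearMap C (C2 C M) ∘ₗ
        (TensorAlgebra.algebraMapInv (R := C) (M := M)).toLinearMap)
      (Algebra.linearMap C (C2 C M) ∘ₗ
        (TensorAlgebra.algebraMapInv (R := C) (M := M)).toLinearMap)

/-- The `C`-module `C₂ ⊗ T(M)`; it carries the product of nested integrals and not the usual product
of a tensor product of algebras. -/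
def GenShuffle : Type _ := C2 C M ⊗[C] TensorAlgebra C M

instance : AddCommGroup (GenShuffle C M) :=
  inferInstanceAs (AddCommGroup (C2 C M ⊗[C] TensorAlgebra C M))

instance : Module C (GenShuffle C M) :=
  inferInstanceAs (Module C (C2 C M ⊗[C] TensorAlgebra C M))

instance : Module (C2 C M) (GenShuffle C M) :=
  inferInstanceAs (Module (C2 C M) (C2 C M ⊗[C] TensorAlgebra C M))

instance : IsScalarTower C (C2 C M) (GenShuffle C M) :=
  inferInstanceAs (IsScalarTower C (C2 C M) (C2 C M ⊗[C] TensorAlgebra C M))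

instance : SMulCommClass (C2 C M) C (GenShuffle C M) :=
  inferInstanceAs (SMulCommClass (C2 C M) C (C2 C M ⊗[C] TensorAlgebra C M))

instance : SMulCommClass C (C2 C M) (GenShuffle C M) := SMulCommClass.symm _ _ _

namespace GenShuffle

/-- The map `t ↦ 1 ⊗ t`. -/
def of : TensorAlgebra C M →ₗ[C] GenShuffle C M :=
  TensorProduct.mk C (C2 C M) (TensorAlgebra C M) 1

/-- The product of `1 ⊗ f` and `1 ⊗ g`: for pure tensors, the sum over all splittings
`f = f₁ⁱ ⊗ fᵢ₊₁ⁿ`, `g = g₁ʲ ⊗ gⱼ₊₁ᵐ` of `ε(fᵢ₊₁ⁿ ⊙ gⱼ₊₁ᵐ) ⊗ (f₁ⁱ ⧢ g₁ʲ)`, where `ε` is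
extended by `ε(1 ⊙ 1) = 1` and by zero if exactly one of its arguments is the empty tensor. -/
def mulT : TensorAlgebra C M →ₗ[C] TensorAlgebra C M →ₗ[C] GenShuffle C M :=
  show TensorAlgebra C M →ₗ[C] TensorAlgebra C M →ₗ[C] C2 C M ⊗[C] TensorAlgebra C M from
    (TensorProduct.map₂ (epsExt C M) shuffle).compl₁₂ decon decon

/-- The product on `C₂ ⊗ T(M)`: `(c ⊗ f) · (d ⊗ g) = (c d) • mulT f g`. -/
def mulAux : GenShuffle C M →ₗ[C] GenShuffle C M →ₗ[C] GenShuffle C M :=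
  show C2 C M ⊗[C] TensorAlgebra C M →ₗ[C] C2 C M ⊗[C] TensorAlgebra C M →ₗ[C] GenShuffle C M from
    (TensorProduct.map₂ (LinearMap.mul C (C2 C M)) (mulT C M)).compr₂
      (TensorProduct.lift (Algebra.lsmul C C (GenShuffle C M) :
        C2 C M →ₐ[C] Module.End C (GenShuffle C M)).toLinearMap)

variable {C M}

lemma of_apply (t : TensorAlgebra C M) : of C M t = (1 : C2 C M) ⊗ₜ[C] t := rfl

lemma smul_of (c : C2 C M) (t : TensorAlgebra C M) : c • of C M t = c ⊗ₜ[C] t := by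
  rw [of_apply]
  exact (TensorProduct.smul_tmul' _ _ _).trans (by rw [smul_eq_mul, mul_one])

lemma mulAux_smul_of (c d : C2 C M) (f g : TensorAlgebra C M) :
    mulAux C M (c • of C M f) (d • of C M g) = (c * d) • mulT C M f g := by
  rw [smul_of, smul_of]
  rfl

lemma mulAux_of_of (f g : TensorAlgebra C M) :
    mulAux C M (of C M f) (of C M g) = mulT C M f g := by
  simpa using mulAux_smul_of 1 1 f g

@[elab_as_elim]
lemma induction {p : GenShuffle C M → Prop} (x : GenShuffle C M)
    (smul_of : ∀ (c : C2 C M) t, p (c • of C M t))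
    (add : ∀ x y, p x → p y → p (x + y)) : p x := by
  refine TensorProduct.induction_on x ?_ ?_ add
  · have := smul_of 0 0
    rwa [zero_smul] at this
  · intro c t
    have := smul_of c t
    rwa [GenShuffle.smul_of] at this

lemma mulAux_smul_left (c : C2 C M) (x y : GenShuffle C M) :
    mulAux C M (c • x) y = c • mulAux C M x y := by
  induction x using induction with
  | smul_of d t =>
    induction y using induction with
    | smul_of e s => rw [smul_smul, mulAux_smul_of, mulAux_smul_of, smul_smul, mul_assoc]
    | add x y hx hy => rw [map_add, map_add, smul_add, hx, hy]
  | add x y hx hy => rw [smul_add, map_add, map_add, LinearMap.add_apply, LinearMap.add_apply,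
      smul_add, hx, hy]

lemma mulAux_smul_right (c : C2 C M) (x y : GenShuffle C M) :
    mulAux C M x (c • y) = c • mulAux C M x y := by
  induction x using induction with
  | smul_of d t =>
    induction y using induction with
    | smul_of e s =>
      rw [smul_smul, mulAux_smul_of, mulAux_smul_of, smul_smul, mul_left_comm]
    | add x y hx hy => rw [smul_add, map_add, map_add, smul_add, hx, hy]
  | add x y hx hy => rw [map_add, LinearMap.add_apply, LinearMap.add_apply,
      smul_add, hx, hy]

/-- Prepending a letter to the tensor factor. -/
def pre (a : M) : GenShuffle C M →ₗ[C2 C M] GenShuffle C M :=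
  (LinearMap.mulLeft C (TensorAlgebra.ι C a) :
    TensorAlgebra C M →ₗ[C] TensorAlgebra C M).baseChange (C2 C M)

@[simp] lemma pre_of (a : M) (t : TensorAlgebra C M) :
    pre a (of C M t) = of C M (TensorAlgebra.ι C a * t) := rfl

lemma epsExt_comm (f g : TensorAlgebra C M) : epsExt C M f g = epsExt C M g f := by
  simp [epsExt, eps, epsSym, SymSquare.mk_comm (posProj C M f), mul_comm]

lemma mulT_apply (f g : TensorAlgebra C M) :
    mulT C M f g = TensorProduct.map₂ (epsExt C M) shuffle (decon f) (decon g) := rfl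

lemma pre_tmul (a : M) (c : C2 C M) (t : TensorAlgebra C M) :
    pre a (c ⊗ₜ[C] t : C2 C M ⊗[C] TensorAlgebra C M) =
      (c ⊗ₜ[C] (TensorAlgebra.ι C a * t) : C2 C M ⊗[C] TensorAlgebra C M) := rfl

/-- The bilinear map of which `mulT` is the composition with deconcatenation. -/
def mm : TensorAlgebra C M ⊗[C] TensorAlgebra C M →ₗ[C]
    TensorAlgebra C M ⊗[C] TensorAlgebra C M →ₗ[C] GenShuffle C M :=
  show TensorAlgebra C M ⊗[C] TensorAlgebra C M →ₗ[C]
    TensorAlgebra C M ⊗[C] TensorAlgebra C M →ₗ[C] C2 C M ⊗[C] TensorAlgebra C M from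
    TensorProduct.map₂ (epsExt C M) shuffle

lemma mulT_eq_mm (f g : TensorAlgebra C M) : mulT C M f g = mm (decon f) (decon g) := rfl

lemma mm_tmul (p q r s : TensorAlgebra C M) :
    mm (p ⊗ₜ[C] q) (r ⊗ₜ[C] s) = epsExt C M p r • of C M (shuffle q s) := by
  rw [smul_of]; rfl

lemma mm_prep_prep (a b : M) (d e : TensorAlgebra C M ⊗[C] TensorAlgebra C M) :
    mm (prep a d) (prep b e) = pre a (mm d (prep b e)) + pre b (mm (prep a d) e) := by
  induction d with
  | zero => simp
  | tmul p q =>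
    induction e with
    | zero => simp
    | tmul r s =>
      simp only [prep_tmul, mm_tmul, shuffle_cons_cons, map_smul, pre_of, map_add, smul_add]
    | add x y hx hy => simp only [map_add, hx, hy]; abel
  | add x y hx hy => simp only [map_add, LinearMap.add_apply, hx, hy]; abel

lemma mm_prep_one (a : M) (d : TensorAlgebra C M ⊗[C] TensorAlgebra C M) (x : TensorAlgebra C M) :
    mm (prep a d) (x ⊗ₜ 1) = pre a (mm d (x ⊗ₜ 1)) := by
  induction d with
  | zero => simp
  | tmul p q => simp [mm_tmul]
  | add x y hx hy => simp only [map_add, LinearMap.add_apply, hx, hy]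

lemma mm_one_prep (a : M) (d : TensorAlgebra C M ⊗[C] TensorAlgebra C M) (x : TensorAlgebra C M) :
    mm (x ⊗ₜ 1) (prep a d) = pre a (mm (x ⊗ₜ 1) d) := by
  induction d with
  | zero => simp
  | tmul p q => simp [mm_tmul]
  | add x y hx hy => simp only [map_add, hx, hy]

/-- The recursion for the product of two tensors of positive length. -/
lemma mulT_cons_cons (a b : M) (f g : TensorAlgebra C M) :
    mulT C M (TensorAlgebra.ι C a * f) (TensorAlgebra.ι C b * g) =
      pre a (mulT C M f (TensorAlgebra.ι C b * g)) + pre b (mulT C M (TensorAlgebra.ι C a * f) g) +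
        epsExt C M (TensorAlgebra.ι C a * f) (TensorAlgebra.ι C b * g) • of C M 1 := by
  simp only [mulT_eq_mm, decon_cons, map_add, LinearMap.add_apply, mm_prep_prep, mm_prep_one,
    mm_one_prep, mm_tmul, one_shuffle]
  abel

lemma epsExt_apply (f g : TensorAlgebra C M) : epsExt C M f g = eps C M f g +
    algebraMap C _ (TensorAlgebra.algebraMapInv f) *
      algebraMap C _ (TensorAlgebra.algebraMapInv g) := rfl

lemma eps_one_left (g : TensorAlgebra C M) : eps C M 1 g = 0 := by simp [eps, epsSym]

lemma eps_one_right (g : TensorAlgebra C M) : eps C M g 1 = 0 := by simp [eps, epsSym]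

lemma mulT_one_left (g : TensorAlgebra C M) : mulT C M 1 g = of C M g := by
  induction g using cons_induction with
  | one => simp [mulT_eq_mm, mm_tmul, epsExt_apply, eps_one_left]
  | cons b g ih =>
    rw [mulT_eq_mm, decon_one] at ih
    rw [mulT_eq_mm, decon_cons, map_add, decon_one, mm_tmul, mm_one_prep, ih]
    simp [epsExt_apply, eps_one_left]
  | add x y hx hy => simp [hx, hy]
  | smul c x hx => simp [hx]

lemma mulT_one_right (g : TensorAlgebra C M) : mulT C M g 1 = of C M g := by
  induction g using cons_induction with
  | one => simp [mulT_eq_mm, mm_tmul, epsExt_apply, eps_one_left]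
  | cons b g ih =>
    rw [mulT_eq_mm, decon_one] at ih
    rw [mulT_eq_mm, decon_cons, map_add, decon_one, LinearMap.add_apply, mm_tmul, mm_prep_one, ih]
    simp [epsExt_apply, eps_one_right]
  | add x y hx hy => simp [hx, hy]
  | smul c x hx => simp [hx]

lemma aug_pureTensor {f : List M} (hf : f ≠ []) :
    TensorAlgebra.algebraMapInv (pureTensor C M f) = 0 :=
  mem_posPart.1 (pureTensor_mem_posPart hf)

/-- The explicit formula for the product of two pure tensors. -/
lemma mulT_pureTensor (f g : List M) :
    mulT C M (pureTensor C M f) (pureTensor C M g) =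
      of C M (shuffle (pureTensor C M f) (pureTensor C M g)) +
        ∑ i ∈ Finset.range f.length, ∑ j ∈ Finset.range g.length,
          eps C M (pureTensor C M (f.drop i)) (pureTensor C M (g.drop j)) •
            of C M (shuffle (pureTensor C M (f.take i)) (pureTensor C M (g.take j))) := by
  have hf : ∀ i ∈ Finset.range f.length,
      TensorAlgebra.algebraMapInv (pureTensor C M (f.drop i)) = 0 := fun i hi =>
    aug_pureTensor (by simpa using hi)
  have hg : ∀ i ∈ Finset.range g.length,
      TensorAlgebra.algebraMapInv (pureTensor C M (g.drop i)) = 0 := fun i hi =>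
    aug_pureTensor (by simpa using hi)
  rw [mulT_eq_mm, decon_pureTensor, decon_pureTensor]
  simp only [map_sum, LinearMap.sum_apply, mm_tmul]
  rw [Finset.sum_comm, Finset.sum_range_succ, Finset.sum_range_succ (n := g.length)]
  have h1 : ∑ j ∈ Finset.range g.length, epsExt C M (pureTensor C M (f.drop f.length))
      (pureTensor C M (g.drop j)) • of C M
        (shuffle (pureTensor C M (f.take f.length)) (pureTensor C M (g.take j))) = 0 := by
    refine Finset.sum_eq_zero fun j hj => ?_
    simp [epsExt_apply, eps_one_left, hg j hj]
  rw [h1, zero_add, add_comm]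
  congr 1
  · simp [epsExt_apply, eps_one_left]
  · refine Finset.sum_congr rfl fun i hi => ?_
    rw [Finset.sum_range_succ]
    simp [epsExt_apply, eps_one_right, hf i hi]

/-- The `C₂`-linear map `c ⊗ t ↦ c ε(t ⊙ h)`. -/
def ev (h : TensorAlgebra C M) : GenShuffle C M →ₗ[C2 C M] C2 C M :=
  show C2 C M ⊗[C] TensorAlgebra C M →ₗ[C2 C M] C2 C M from
    LinearMap.liftBaseChange (C2 C M) ((epsExt C M).flip h)

@[simp] lemma ev_of (h t : TensorAlgebra C M) : ev h (of C M t) = epsExt C M t h := by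
  rw [of_apply]
  exact (LinearMap.liftBaseChange_tmul _ _ _ _).trans (one_smul _ _)

lemma ev_add (h h' : TensorAlgebra C M) (x : GenShuffle C M) :
    ev (h + h') x = ev h x + ev h' x := by
  induction x using induction with
  | smul_of c t => simp [mul_add]
  | add x y hx hy => simp only [map_add, hx, hy]; abel

lemma ev_smul (c : C) (h : TensorAlgebra C M) (x : GenShuffle C M) :
    ev (c • h) x = c • ev h x := by
  induction x using induction with
  | smul_of c t => simp
  | add x y hx hy => simp only [map_add, hx, hy, smul_add]

lemma ev_csmul (c : C) (h : TensorAlgebra C M) (x : GenShuffle C M) :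
    ev h (c • x) = c • ev h x := by
  rw [← algebraMap_smul (C2 C M) c x, map_smul, algebraMap_smul]

lemma epsExt_right_of_ne {h : List M} (hh : h ≠ []) (x : TensorAlgebra C M) :
    epsExt C M x (pureTensor C M h) = eps C M x (pureTensor C M h) := by
  simp [epsExt_apply, aug_pureTensor hh]

lemma sum_Ico_eq {F : ℕ → ℕ → C2 C M} (h0 : F 0 0 = 0) (n j : ℕ) :
    ∑ i ∈ Finset.Ico (1 - j) n, F i j = ∑ i ∈ Finset.range n, F i j := by
  refine Finset.sum_subset (fun i hi => by simp at hi ⊢; omega) fun i hi hi' => ?_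
  simp only [Finset.mem_range, Finset.mem_Ico, not_and] at hi hi'
  have : i = 0 ∧ j = 0 := by
    constructor <;> by_contra hne <;> exact hi' (by omega) hi
  rw [this.1, this.2, h0]

lemma eps_comm (f g : TensorAlgebra C M) : eps C M f g = eps C M g f := by
  simp [eps, epsSym, SymSquare.mk_comm (posProj C M f)]

lemma cocycle_pureTensor {f g h : List M} (hf : f ≠ []) (hg : g ≠ []) (hh : h ≠ []) :
    ev (pureTensor C M h) (mulT C M (pureTensor C M f) (pureTensor C M g)) =
      ev (pureTensor C M f) (mulT C M (pureTensor C M g) (pureTensor C M h)) := by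
  have hrel : toC2 C M (constRel C M f g h) = 0 :=
    Ideal.Quotient.eq_zero_iff_mem.2 (Ideal.subset_span ⟨f, g, h, hf, hg, hh, rfl⟩)
  have he : ∀ x y, toC2 C M (epsSym C M x y) = eps C M x y := fun _ _ => rfl
  simp only [constRel, map_add, map_sub, map_sum, map_mul, he] at hrel
  rw [Finset.sum_congr rfl fun j _ => congrArg₂ (· - ·)
      (sum_Ico_eq (F := fun i j => eps C M (pureTensor C M (f.drop i)) (pureTensor C M (g.drop j)) *
            eps C M (shuffle (pureTensor C M (f.take i)) (pureTensor C M (g.take j)))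
              (pureTensor C M h)) (by simp [eps_one_left]) f.length j)
      (sum_Ico_eq (F := fun k j => eps C M (pureTensor C M f)
              (shuffle (pureTensor C M (g.take j)) (pureTensor C M (h.take k))) *
            eps C M (pureTensor C M (g.drop j)) (pureTensor C M (h.drop k)))
              (by simp [eps_one_right]) h.length j),
    Finset.sum_sub_distrib] at hrel
  simp only [mulT_pureTensor, map_add, map_sum, map_smul, ev_of, smul_eq_mul,
    epsExt_right_of_ne hf, epsExt_right_of_ne hh]
  rw [Finset.sum_comm]
  simp only [eps_comm _ (pureTensor C M f)]
  simp only [mul_comm (eps C M (pureTensor C M f) _)] at hrel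
  linear_combination hrel

lemma cocycle (a b c : M) (f g h : TensorAlgebra C M) :
    ev (TensorAlgebra.ι C c * h)
        (mulT C M (TensorAlgebra.ι C a * f) (TensorAlgebra.ι C b * g)) =
      ev (TensorAlgebra.ι C a * f)
        (mulT C M (TensorAlgebra.ι C b * g) (TensorAlgebra.ι C c * h)) := by
  induction f using pure_induction with
  | pure f =>
    induction g using pure_induction with
    | pure g =>
      induction h using pure_induction with
      | pure h =>
        simpa using cocycle_pureTensor (C := C) (f := a :: f) (g := b :: g) (h := c :: h)
          (by simp) (by simp) (by simp)
      | add x y hx hy => simp only [mul_add, map_add, ev_add, hx, hy]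
      | smul r x hx => simp only [mul_smul_comm, map_smul, ev_smul, ev_csmul, hx]
    | add x y hx hy => simp only [mul_add, map_add, LinearMap.add_apply, hx, hy]
    | smul r x hx =>
      simp only [mul_smul_comm, map_smul, LinearMap.smul_apply, ev_csmul, hx]
  | add x y hx hy => simp only [mul_add, map_add, LinearMap.add_apply, ev_add, hx, hy]
  | smul r x hx =>
    simp only [mul_smul_comm, map_smul, LinearMap.smul_apply, ev_smul, ev_csmul, hx]

lemma mulT_comm (f g : TensorAlgebra C M) : mulT C M f g = mulT C M g f := by
  induction f using cons_induction generalizing g with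
  | one => rw [mulT_one_left, mulT_one_right]
  | cons a t iht =>
    induction g using cons_induction with
    | one => rw [mulT_one_left, mulT_one_right]
    | cons b s ihs =>
      rw [mulT_cons_cons, mulT_cons_cons, iht, ihs, epsExt_comm,
        add_comm (pre a _)]
    | add x y hx hy => simp [hx, hy]
    | smul c x hx => simp [hx]
  | add x y hx hy => simp [hx, hy]
  | smul c x hx => simp [hx]


lemma mulAux_comm (x y : GenShuffle C M) : mulAux C M x y = mulAux C M y x := by
  induction x using induction with
  | smul_of d t =>
    induction y using induction with
    | smul_of e s => rw [mulAux_smul_of, mulAux_smul_of, mulT_comm, mul_comm]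
    | add x y hx hy => rw [map_add, map_add, LinearMap.add_apply, hx, hy]
  | add x y hx hy => rw [map_add, map_add, LinearMap.add_apply, hx, hy]

lemma one_mulAux (x : GenShuffle C M) : mulAux C M (of C M 1) x = x := by
  induction x using induction with
  | smul_of d t => rw [mulAux_smul_right, mulAux_of_of, mulT_one_left]
  | add x y hx hy => rw [map_add, hx, hy]

lemma pre_mulAux (a c : M) (h : TensorAlgebra C M) (u : GenShuffle C M) :
    mulAux C M (pre a u) (of C M (TensorAlgebra.ι C c * h)) =
      pre a (mulAux C M u (of C M (TensorAlgebra.ι C c * h))) +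
        pre c (mulAux C M (pre a u) (of C M h)) +
        ev (TensorAlgebra.ι C c * h) (pre a u) • of C M 1 := by
  induction u using induction with
  | smul_of d t =>
    simp only [map_smul, pre_of, mulAux_smul_left, mulAux_of_of, mulT_cons_cons, ev_of, smul_add,
      smul_eq_mul, mul_smul]
  | add x y hx hy =>
    simp only [map_add, LinearMap.add_apply, hx, hy, add_smul]
    abel

lemma mulAux_assoc_cons (a b c : M) (f g h : TensorAlgebra C M) :
    mulAux C M (mulT C M (TensorAlgebra.ι C a * f) (TensorAlgebra.ι C b * g))
        (of C M (TensorAlgebra.ι C c * h)) =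
      pre a (mulAux C M (mulT C M f (TensorAlgebra.ι C b * g)) (of C M (TensorAlgebra.ι C c * h))) +
      pre b (mulAux C M (mulT C M (TensorAlgebra.ι C a * f) g) (of C M (TensorAlgebra.ι C c * h))) +
      pre c (mulAux C M (mulT C M (TensorAlgebra.ι C a * f) (TensorAlgebra.ι C b * g))
        (of C M h)) +
      ev (TensorAlgebra.ι C c * h)
        (mulT C M (TensorAlgebra.ι C a * f) (TensorAlgebra.ι C b * g)) • of C M 1 := by
  rw [mulT_cons_cons]
  simp only [map_add, LinearMap.add_apply, pre_mulAux, mulAux_smul_left, one_mulAux, map_smul,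
    ev_of, pre_of, add_smul]
  simp only [epsExt_apply, eps_one_left, aug_cons, map_zero, mul_zero, add_zero, smul_zero,
    zero_smul]
  abel

lemma mulAux_assoc_of (f g h : TensorAlgebra C M) :
    mulAux C M (mulT C M f g) (of C M h) = mulAux C M (of C M f) (mulT C M g h) := by
  induction f using cons_induction generalizing g h with
  | one => rw [mulT_one_left, mulAux_of_of, one_mulAux]
  | cons a f ihf =>
    induction g using cons_induction generalizing h with
    | one => rw [mulT_one_left, mulT_one_right, mulAux_of_of]
    | cons b g ihg =>
      induction h using cons_induction with
      | one => rw [mulT_one_right, mulAux_comm, one_mulAux, mulAux_of_of]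
      | cons c h ihh =>
        rw [mulAux_assoc_cons, ihf, ihg, ihh,
          mulAux_comm (of C M (TensorAlgebra.ι C a * f))
            (mulT C M (TensorAlgebra.ι C b * g) (TensorAlgebra.ι C c * h)),
          mulAux_assoc_cons, mulAux_comm (of C M f),
          mulAux_comm (of C M (TensorAlgebra.ι C a * f)) (mulT C M g (TensorAlgebra.ι C c * h)),
          mulAux_comm (of C M (TensorAlgebra.ι C a * f)) (mulT C M (TensorAlgebra.ι C b * g) h),
          cocycle]
        abel
      | add x y hx hy => simp only [map_add, hx, hy]
      | smul r x hx => simp only [map_smul, hx]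
    | add x y hx hy => simp only [map_add, LinearMap.add_apply, hx, hy]
    | smul r x hx => simp only [map_smul, LinearMap.smul_apply, hx]
  | add x y hx hy => simp only [map_add, LinearMap.add_apply, hx, hy]
  | smul r x hx => simp only [map_smul, LinearMap.smul_apply, hx]

lemma mulAux_assoc (x y z : GenShuffle C M) :
    mulAux C M (mulAux C M x y) z = mulAux C M x (mulAux C M y z) := by
  induction x using induction with
  | smul_of c f =>
    induction y using induction with
    | smul_of d g =>
      induction z using induction with
      | smul_of e h =>
        simp only [mulAux_smul_left, mulAux_smul_right, mulAux_of_of, mulAux_assoc_of]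
      | add x y hx hy => simp only [map_add, hx, hy]
    | add x y hx hy => simp only [map_add, LinearMap.add_apply, hx, hy]
  | add x y hx hy => simp only [map_add, LinearMap.add_apply, hx, hy]

instance : CommRing (GenShuffle C M) where
  __ := (inferInstance : AddCommGroup (GenShuffle C M))
  mul x y := mulAux C M x y
  one := of C M 1
  left_distrib x y z := map_add (mulAux C M x) y z
  right_distrib x y z := LinearMap.map_add₂ (mulAux C M) x y z
  zero_mul x := LinearMap.map_zero₂ (mulAux C M) x
  mul_zero x := map_zero (mulAux C M x)
  mul_assoc := mulAux_assoc
  one_mul := one_mulAux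
  mul_one x := (mulAux_comm x _).trans (one_mulAux x)
  mul_comm := mulAux_comm

lemma mul_def (x y : GenShuffle C M) : x * y = mulAux C M x y := rfl

lemma one_def : (1 : GenShuffle C M) = of C M 1 := rfl

instance : Algebra (C2 C M) (GenShuffle C M) :=
  Algebra.ofModule mulAux_smul_left (fun r x y => mulAux_smul_right r x y)

instance : Algebra C (GenShuffle C M) :=
  Algebra.ofModule (fun r x y => LinearMap.map_smul₂ (mulAux C M) r x y)
    (fun r x y => map_smul (mulAux C M x) r y)

/-- The product of two tensors `c ⊗ f` and `d ⊗ g` with `f`, `g` pure. -/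
lemma tmul_mul_tmul (c d : C2 C M) (f g : List M) :
    (c • of C M (pureTensor C M f)) * (d • of C M (pureTensor C M g)) =
      (c * d) • of C M (shuffle (pureTensor C M f) (pureTensor C M g)) +
        ∑ i ∈ Finset.range f.length, ∑ j ∈ Finset.range g.length,
          (c * d * eps C M (pureTensor C M (f.drop i)) (pureTensor C M (g.drop j))) •
            of C M (shuffle (pureTensor C M (f.take i)) (pureTensor C M (g.take j))) := by
  rw [mul_def, mulAux_smul_of, mulT_pureTensor, smul_add, Finset.smul_sum]
  simp only [Finset.smul_sum, smul_smul]

end GenShuffle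

end Shuffle

namespace IntegroDiff

open Shuffle

variable {C R : Type*} [CommRing C] [CommRing R] [Algebra C R]

/-- The algebra `C̃₁ = Sym(ε(R_J ⊗ T̃))`, where `R_J` is the image of `Q` and
`T̃ = ⨁_{n ≥ 1} R_T^{⊗ n}` with `R_T` the kernel of `Q`. -/
def C1 (Q : R →ₗ[C] R) : Type _ :=
  SymmetricAlgebra C (LinearMap.range Q ⊗[C] posPart C (LinearMap.ker Q))

instance (Q : R →ₗ[C] R) : CommRing (C1 Q) :=
  inferInstanceAs (CommRing
    (SymmetricAlgebra C (LinearMap.range Q ⊗[C] posPart C (LinearMap.ker Q))))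

instance (Q : R →ₗ[C] R) : Algebra C (C1 Q) :=
  inferInstanceAs (Algebra C
    (SymmetricAlgebra C (LinearMap.range Q ⊗[C] posPart C (LinearMap.ker Q))))

/-- The `C`-algebra `R ⊗ C̃₁ ⊗ (C₂ ⊗ T)`, with `T = T(R_T)`; the last factor carries the product of
nested integrals. -/
def IDRAlg (Q : R →ₗ[C] R) : Type _ := R ⊗[C] (C1 Q ⊗[C] GenShuffle C (LinearMap.ker Q))

lemma tmul_three {A B D : Type*} [CommRing A] [CommRing B] [CommRing D] [Algebra C A] [Algebra C B]
    [Algebra C D] (a : A) (b : B) (u : D) :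
    (Algebra.TensorProduct.includeLeft : A →ₐ[C] A ⊗[C] (B ⊗[C] D)) a *
      ((Algebra.TensorProduct.includeRight : B ⊗[C] D →ₐ[C] A ⊗[C] (B ⊗[C] D))
          ((Algebra.TensorProduct.includeLeft : B →ₐ[C] B ⊗[C] D) b) *
        (Algebra.TensorProduct.includeRight : B ⊗[C] D →ₐ[C] A ⊗[C] (B ⊗[C] D))
          ((Algebra.TensorProduct.includeRight : D →ₐ[C] B ⊗[C] D) u)) =
      a ⊗ₜ[C] (b ⊗ₜ[C] u) := by
  simp

namespace IDRAlg

variable (Q : R →ₗ[C] R)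

instance : CommRing (IDRAlg Q) :=
  inferInstanceAs (CommRing (R ⊗[C] (C1 Q ⊗[C] GenShuffle C (LinearMap.ker Q))))

instance : Algebra C (IDRAlg Q) :=
  inferInstanceAs (Algebra C (R ⊗[C] (C1 Q ⊗[C] GenShuffle C (LinearMap.ker Q))))

/-- The map `f ↦ f ⊗ 1 ⊗ 1 ⊗ 1`. -/
def ofR : R →ₐ[C] IDRAlg Q :=
  (Algebra.TensorProduct.includeLeft :
    R →ₐ[C] R ⊗[C] (C1 Q ⊗[C] GenShuffle C (LinearMap.ker Q)))

/-- The map `c ↦ 1 ⊗ c ⊗ 1 ⊗ 1`. -/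
def ofC1 : C1 Q →ₐ[C] IDRAlg Q :=
  (Algebra.TensorProduct.includeRight :
    C1 Q ⊗[C] GenShuffle C (LinearMap.ker Q) →ₐ[C]
      R ⊗[C] (C1 Q ⊗[C] GenShuffle C (LinearMap.ker Q))).comp
    (Algebra.TensorProduct.includeLeft : C1 Q →ₐ[C] C1 Q ⊗[C] GenShuffle C (LinearMap.ker Q))

/-- The map `u ↦ 1 ⊗ 1 ⊗ u`. -/
def ofGS : GenShuffle C (LinearMap.ker Q) →ₐ[C] IDRAlg Q :=
  (Algebra.TensorProduct.includeRight :
    C1 Q ⊗[C] GenShuffle C (LinearMap.ker Q) →ₐ[C]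
      R ⊗[C] (C1 Q ⊗[C] GenShuffle C (LinearMap.ker Q))).comp
    (Algebra.TensorProduct.includeRight :
      GenShuffle C (LinearMap.ker Q) →ₐ[C] C1 Q ⊗[C] GenShuffle C (LinearMap.ker Q))

/-- The map `c ↦ 1 ⊗ 1 ⊗ c ⊗ 1`. -/
def ofC2 : C2 C (LinearMap.ker Q) →ₐ[C] IDRAlg Q :=
  (ofGS Q).comp (IsScalarTower.toAlgHom C (C2 C (LinearMap.ker Q)) (GenShuffle C (LinearMap.ker Q)))

/-- The map `t ↦ 1 ⊗ 1 ⊗ 1 ⊗ t`. -/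
def ofT : TensorAlgebra C (LinearMap.ker Q) →ₗ[C] IDRAlg Q :=
  (ofGS Q).toLinearMap ∘ₗ GenShuffle.of C (LinearMap.ker Q)

/-- The tensor `f ⊗ c₁ ⊗ c₂ ⊗ t`. -/
def tens (f : R) (c₁ : C1 Q) (c₂ : C2 C (LinearMap.ker Q))
    (t : TensorAlgebra C (LinearMap.ker Q)) : IDRAlg Q :=
  (show R ⊗[C] (C1 Q ⊗[C] GenShuffle C (LinearMap.ker Q)) from
    f ⊗ₜ[C] (c₁ ⊗ₜ[C] (show GenShuffle C (LinearMap.ker Q) from c₂ ⊗ₜ[C] t)))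

variable {Q}

lemma tens_eq (f : R) (c₁ : C1 Q) (c₂ : C2 C (LinearMap.ker Q))
    (t : TensorAlgebra C (LinearMap.ker Q)) :
    tens Q f c₁ c₂ t = ofR Q f * (ofC1 Q c₁ * (ofC2 Q c₂ * ofT Q t)) := by
  have h : ofC2 Q c₂ * ofT Q t = ofGS Q (c₂ • GenShuffle.of C _ t) := by
    rw [Algebra.smul_def, map_mul]
    rfl
  rw [h, GenShuffle.smul_of]
  exact (tmul_three f c₁ _).symm

@[elab_as_elim]
lemma induction {p : IDRAlg Q → Prop} (x : IDRAlg Q)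
    (tens : ∀ f c₁ c₂ t, p (ofR Q f * (ofC1 Q c₁ * (ofC2 Q c₂ * ofT Q t))))
    (add : ∀ x y, p x → p y → p (x + y)) : p x := by
  have h0 : p 0 := by simpa using tens 0 0 0 0
  have h3 : ∀ (f : R) (c₁ : C1 Q) (u : GenShuffle C (LinearMap.ker Q)),
      p (ofR Q f * (ofC1 Q c₁ * ofGS Q u)) := by
    intro f c₁ u
    induction u using GenShuffle.induction with
    | smul_of c₂ t =>
      rw [Algebra.smul_def, map_mul]
      exact tens f c₁ c₂ t
    | add x y hx hy => rw [map_add, mul_add, mul_add]; exact add _ _ hx hy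
  have h2 : ∀ (f : R) (v : C1 Q ⊗[C] GenShuffle C (LinearMap.ker Q)),
      p (show R ⊗[C] (C1 Q ⊗[C] GenShuffle C (LinearMap.ker Q)) from f ⊗ₜ[C] v) := by
    intro f v
    induction v with
    | zero => rw [TensorProduct.tmul_zero]; exact h0
    | tmul c₁ u =>
      have := h3 f c₁ u
      rw [← tmul_three]
      exact this
    | add x y hx hy => rw [TensorProduct.tmul_add]; exact add _ _ hx hy
  exact TensorProduct.induction_on x h0 h2 add

variable (Q) in
/-- The linear extension of `f ⊗ c₁ ⊗ c₂ ⊗ t ↦ c₁ c₂ F(f, t)`, for a bilinear map `F`. -/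
def ext (F : R →ₗ[C] TensorAlgebra C (LinearMap.ker Q) →ₗ[C] IDRAlg Q) :
    IDRAlg Q →ₗ[C] IDRAlg Q :=
  show R ⊗[C] (C1 Q ⊗[C] (C2 C (LinearMap.ker Q) ⊗[C] TensorAlgebra C (LinearMap.ker Q))) →ₗ[C]
      IDRAlg Q from
    TensorProduct.lift ((LinearMap.mul C (IDRAlg Q)).compl₁₂ (ofC1 Q).toLinearMap
      (TensorProduct.lift ((LinearMap.mul C (IDRAlg Q)).compl₁₂ (ofC2 Q).toLinearMap
        (TensorProduct.lift F)))) ∘ₗ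
    (TensorProduct.leftComm C R (C2 C (LinearMap.ker Q))
      (TensorAlgebra C (LinearMap.ker Q))).toLinearMap.lTensor (C1 Q) ∘ₗ
    (TensorProduct.leftComm C R (C1 Q) (C2 C (LinearMap.ker Q) ⊗[C]
      TensorAlgebra C (LinearMap.ker Q))).toLinearMap

lemma ext_tens (F : R →ₗ[C] TensorAlgebra C (LinearMap.ker Q) →ₗ[C] IDRAlg Q)
    (f : R) (c₁ : C1 Q) (c₂ : C2 C (LinearMap.ker Q)) (t : TensorAlgebra C (LinearMap.ker Q)) :
    ext Q F (ofR Q f * (ofC1 Q c₁ * (ofC2 Q c₂ * ofT Q t))) =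
      ofC1 Q c₁ * (ofC2 Q c₂ * F f t) := by
  rw [← tens_eq]
  rfl

/-- The map on `T` with `1 ↦ 0` and `f₁ ⊗ ⋯ ⊗ fₙ ↦ f₁ ⊗ 1 ⊗ 1 ⊗ (f₂ ⊗ ⋯ ⊗ fₙ)`. -/
def shift : TensorAlgebra C (LinearMap.ker Q) →ₗ[C] IDRAlg Q :=
  primRec 0 (LinearMap.mk₂ C (fun a p => ofR Q (a : R) * ofT Q p.1)
    (by intros; simp [add_mul]) (by intros; simp)
    (by intros; simp [mul_add]) (by intros; simp))

@[simp] lemma shift_one : shift (Q := Q) 1 = 0 := by simp [shift]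

@[simp] lemma shift_cons (a : LinearMap.ker Q) (t : TensorAlgebra C (LinearMap.ker Q)) :
    shift (TensorAlgebra.ι C a * t) = ofR Q (a : R) * ofT Q t := by simp [shift]

variable (Q) in
/-- The derivation:
`∂(f₀ ⊗ c ⊗ f) = (∂f₀) ⊗ c ⊗ f + (f₀ f₁) ⊗ c ⊗ (f₂ ⊗ ⋯ ⊗ fₙ)`,
where the second summand is absent if `n = 0`. -/
def derivMap (d : Derivation C R R) : IDRAlg Q →ₗ[C] IDRAlg Q :=
  ext Q ((LinearMap.mul C (IDRAlg Q)).compl₁₂ ((ofR Q).toLinearMap ∘ₗ d.toLinearMap) (ofT Q) +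
    (LinearMap.mul C (IDRAlg Q)).compl₁₂ (ofR Q).toLinearMap shift)

variable (Q) in
/-- The isomorphism `ε` from `R_J ⊗ T̃` onto the generators of `C̃₁`. -/
def epsC1 : LinearMap.range Q ⊗[C] posPart C (LinearMap.ker Q) →ₗ[C] C1 Q :=
  SymmetricAlgebra.ι C (LinearMap.range Q ⊗[C] posPart C (LinearMap.ker Q))

variable (Q) in
/-- The bilinear map sending `(f₀, t)` to `ε((Q f₀) ⊗ t)`, with `t` first projected from `T` to
`T̃`. -/
def eps1 : R →ₗ[C] TensorAlgebra C (LinearMap.ker Q) →ₗ[C] C1 Q :=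
  ((TensorProduct.mk C (LinearMap.range Q) (posPart C (LinearMap.ker Q))).compl₁₂
    Q.rangeRestrict (posProj C (LinearMap.ker Q))).compr₂ (epsC1 Q)

lemma eps1_one (f : R) : eps1 Q f 1 = 0 := by
  simp [eps1]

section

variable (d : Derivation C R R) (hQ : ∀ f, Q (d (Q f)) = Q f)

/-- The projector `f ↦ f - ∂ Q f` onto `R_T`. -/
def projT : R →ₗ[C] LinearMap.ker Q :=
  LinearMap.codRestrict (LinearMap.ker Q) (LinearMap.id - d.toLinearMap ∘ₗ Q)
    (fun f => by simp [hQ])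

@[simp] lemma coe_projT (f : R) : (projT d hQ f : R) = f - d (Q f) := rfl

/-- The non-recursive part of the integral of `f₀ ⊗ 1 ⊗ 1 ⊗ t`. -/
def intBase : TensorAlgebra C (LinearMap.ker Q) →ₗ[C] R →ₗ[C] IDRAlg Q :=
  LinearMap.flip (
    (LinearMap.mul C (IDRAlg Q)).compl₁₂ ((ofR Q).toLinearMap ∘ₗ Q) (ofT Q) -
    (eps1 Q).compr₂ (ofC1 Q).toLinearMap +
    ((LinearMap.mul C (TensorAlgebra C (LinearMap.ker Q))) ∘ₗ
      (TensorAlgebra.ι C ∘ₗ projT d hQ)).compr₂ (ofT Q))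

lemma intBase_apply (t : TensorAlgebra C (LinearMap.ker Q)) (f : R) :
    intBase d hQ t f = ofR Q (Q f) * ofT Q t - ofC1 Q (eps1 Q f t) +
      ofT Q (TensorAlgebra.ι C (projT d hQ f) * t) := rfl

/-- The map `(t, f₀) ↦ ∫(f₀ ⊗ 1 ⊗ 1 ⊗ t)`, by recursion on the tensor `t`. -/
def intCore : TensorAlgebra C (LinearMap.ker Q) →ₗ[C] R →ₗ[C] IDRAlg Q :=
  primRec (intBase d hQ 1) (LinearMap.mk₂ C
    (fun a p => intBase d hQ (TensorAlgebra.ι C a * p.1) -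
      p.2 ∘ₗ LinearMap.mulRight C (a : R) ∘ₗ Q)
    (by
      intro a b p
      have h : LinearMap.mulRight C ((a + b : LinearMap.ker Q) : R) =
        LinearMap.mulRight C (a : R) + LinearMap.mulRight C (b : R) := by
        ext; simp [mul_add]
      rw [h, LinearMap.add_comp, LinearMap.comp_add, map_add, add_mul, map_add]
      abel)
    (by
      intro c a p
      have h : LinearMap.mulRight C ((c • a : LinearMap.ker Q) : R) =
        c • LinearMap.mulRight C (a : R) := by
        ext; simp
      rw [h, LinearMap.smul_comp, LinearMap.comp_smul, map_smul, smul_mul_assoc, map_smul,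
        smul_sub])
    (by
      intro a p q
      rw [Prod.fst_add, Prod.snd_add, mul_add, map_add, LinearMap.add_comp]
      abel)
    (by
      intro c a p
      rw [Prod.smul_fst, Prod.smul_snd, mul_smul_comm, map_smul, LinearMap.smul_comp, smul_sub]))

lemma intCore_one (f : R) :
    intCore d hQ 1 f = ofR Q (Q f) + ofT Q (TensorAlgebra.ι C (projT d hQ f)) := by
  have h : ofT Q 1 = 1 := map_one (ofGS Q)
  simp [intCore, intBase_apply, eps1_one, h]

lemma intCore_cons (a : LinearMap.ker Q) (t : TensorAlgebra C (LinearMap.ker Q)) (f : R) :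
    intCore d hQ (TensorAlgebra.ι C a * t) f =
      ofR Q (Q f) * ofT Q (TensorAlgebra.ι C a * t) -
        ofC1 Q (eps1 Q f (TensorAlgebra.ι C a * t)) - intCore d hQ t (Q f * a) +
        ofT Q (TensorAlgebra.ι C (projT d hQ f) * (TensorAlgebra.ι C a * t)) := by
  have : intCore d hQ (TensorAlgebra.ι C a * t) f = intBase d hQ (TensorAlgebra.ι C a * t) f -
      intCore d hQ t (Q f * a) := by
    simp [intCore]
  rw [this, intBase_apply]
  abel

/-- The integration: `∫(f₀ ⊗ c₁ ⊗ c₂ ⊗ f)` equals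
`(Q f₀) ⊗ c₁ ⊗ c₂ ⊗ f + 1 ⊗ c₁ ⊗ c₂ ⊗ ((f₀ - ∂ Q f₀) ⊗ f)` for `n = 0` and
`(Q f₀) ⊗ c₁ ⊗ c₂ ⊗ f - 1 ⊗ (c₁ ε((Q f₀) ⊗ f)) ⊗ c₂ ⊗ 1
- ∫(((Q f₀) f₁) ⊗ c₁ ⊗ c₂ ⊗ (f₂ ⊗ ⋯ ⊗ fₙ)) + 1 ⊗ c₁ ⊗ c₂ ⊗ ((f₀ - ∂ Q f₀) ⊗ f)` for `n > 0`. -/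
def intMap : IDRAlg Q →ₗ[C] IDRAlg Q := ext Q (intCore d hQ).flip

end

end IDRAlg

end IntegroDiff
namespace IntegroDiff

open Shuffle

namespace IDRAlg

variable {C R : Type*} [CommRing C] [CommRing R] [Algebra C R] {Q : R →ₗ[C] R}

lemma ofT_one : ofT Q 1 = 1 := map_one (ofGS Q)

lemma ofC2_mul_ofT (c : C2 C (LinearMap.ker Q)) (t : TensorAlgebra C (LinearMap.ker Q)) :
    ofC2 Q c * ofT Q t = ofGS Q (c • GenShuffle.of C _ t) := by
  rw [Algebra.smul_def, map_mul]
  rfl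

section deriv

variable (d : Derivation C R R)

lemma derivMap_tens (f : R) (c₁ : C1 Q) (c₂ : C2 C (LinearMap.ker Q))
    (t : TensorAlgebra C (LinearMap.ker Q)) :
    derivMap Q d (ofR Q f * (ofC1 Q c₁ * (ofC2 Q c₂ * ofT Q t))) =
      ofC1 Q c₁ * (ofC2 Q c₂ * (ofR Q (d f) * ofT Q t + ofR Q f * shift t)) :=
  ext_tens _ _ _ _ _

lemma derivMap_ofC2_ofT (c : C2 C (LinearMap.ker Q)) (t : TensorAlgebra C (LinearMap.ker Q)) :
    derivMap Q d (ofC2 Q c * ofT Q t) = ofC2 Q c * shift t := by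
  simpa using derivMap_tens d 1 1 c t

lemma derivMap_ofC2_ofGS (c : C2 C (LinearMap.ker Q)) (u : GenShuffle C (LinearMap.ker Q)) :
    derivMap Q d (ofGS Q (c • u)) = ofC2 Q c * derivMap Q d (ofGS Q u) := by
  induction u using GenShuffle.induction with
  | smul_of e t =>
    rw [smul_smul, ← ofC2_mul_ofT, ← ofC2_mul_ofT, derivMap_ofC2_ofT, derivMap_ofC2_ofT, map_mul,
      mul_assoc]
  | add x y hx hy => rw [smul_add, map_add, map_add, hx, hy, map_add, map_add, mul_add]

lemma derivMap_ofT (t : TensorAlgebra C (LinearMap.ker Q)) :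
    derivMap Q d (ofT Q t) = shift t := by
  simpa using derivMap_tens d 1 1 1 t

lemma derivMap_gen (f : R) (c : C1 Q) (u : GenShuffle C (LinearMap.ker Q)) :
    derivMap Q d (ofR Q f * (ofC1 Q c * ofGS Q u)) =
      ofR Q (d f) * (ofC1 Q c * ofGS Q u) + ofR Q f * (ofC1 Q c * derivMap Q d (ofGS Q u)) := by
  induction u using GenShuffle.induction with
  | smul_of e t =>
    rw [← ofC2_mul_ofT, derivMap_tens, derivMap_ofC2_ofT]
    ring
  | add x y hx hy =>
    simp only [map_add, mul_add, hx, hy]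
    ring

lemma derivMap_pre (a : LinearMap.ker Q) (u : GenShuffle C (LinearMap.ker Q)) :
    derivMap Q d (ofGS Q (GenShuffle.pre a u)) = ofR Q (a : R) * ofGS Q u := by
  induction u using GenShuffle.induction with
  | smul_of e t =>
    rw [map_smul, GenShuffle.pre_of, ← ofC2_mul_ofT, ← ofC2_mul_ofT, derivMap_ofC2_ofT, shift_cons]
    ring
  | add x y hx hy => simp only [map_add, mul_add, hx, hy]

lemma ofT_mul_ofT (s t : TensorAlgebra C (LinearMap.ker Q)) :
    ofT Q s * ofT Q t = ofGS Q (GenShuffle.mulT C _ s t) := by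
  rw [← GenShuffle.mulAux_of_of]
  exact (map_mul (ofGS Q) _ _).symm

lemma derivMap_ofT_mul (s t : TensorAlgebra C (LinearMap.ker Q)) :
    derivMap Q d (ofT Q s * ofT Q t) = shift s * ofT Q t + ofT Q s * shift t := by
  induction s using cons_induction with
  | one => rw [ofT_one, one_mul, shift_one, zero_mul, one_mul, zero_add, derivMap_ofT]
  | cons a s ih =>
    clear ih
    induction t using cons_induction with
    | one => rw [ofT_one, mul_one, shift_one, mul_zero, mul_one, add_zero, derivMap_ofT]
    | cons b t _ =>
      rw [ofT_mul_ofT, GenShuffle.mulT_cons_cons, map_add, map_add, map_add, map_add, derivMap_pre,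
        derivMap_pre, ← ofC2_mul_ofT, derivMap_ofC2_ofT, shift_one, mul_zero, add_zero, shift_cons,
        shift_cons, ← ofT_mul_ofT, ← ofT_mul_ofT]
      ring
    | add x y hx hy => simp only [map_add, mul_add, hx, hy]; ring
    | smul r x hx => simp only [map_smul, mul_smul_comm, hx, smul_add]
  | add x y hx hy => simp only [map_add, add_mul, hx, hy]; ring
  | smul r x hx => simp only [map_smul, smul_mul_assoc, hx, smul_add]

lemma derivMap_mul (x y : IDRAlg Q) :
    derivMap Q d (x * y) = x * derivMap Q d y + y * derivMap Q d x := by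
  induction x using induction with
  | tens f c₁ c₂ s =>
    induction y using induction with
    | tens g e₁ e₂ t =>
      have h : ofR Q f * (ofC1 Q c₁ * (ofC2 Q c₂ * ofT Q s)) *
          (ofR Q g * (ofC1 Q e₁ * (ofC2 Q e₂ * ofT Q t))) =
          ofR Q (f * g) * (ofC1 Q (c₁ * e₁) * ofGS Q ((c₂ * e₂) • GenShuffle.mulT C _ s t)) := by
        rw [Algebra.smul_def, map_mul (ofGS Q), ← ofT_mul_ofT, map_mul, map_mul, map_mul, map_mul]
        simp only [ofC2, AlgHom.comp_apply, IsScalarTower.coe_toAlgHom']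
        ring
      rw [h, derivMap_gen, derivMap_ofC2_ofGS, ← ofT_mul_ofT, derivMap_ofT_mul, derivMap_tens,
        derivMap_tens, Algebra.smul_def, map_mul (ofGS Q), ← ofT_mul_ofT, d.leibniz]
      have h2 : ofGS Q (algebraMap _ _ (c₂ * e₂)) = ofC2 Q c₂ * ofC2 Q e₂ :=
        map_mul (ofC2 Q) c₂ e₂
      rw [h2]
      simp only [smul_eq_mul, map_mul, map_add]
      ring
    | add x y hx hy => simp only [map_add, mul_add, add_mul, hx, hy]; ring
  | add x y hx hy => simp only [map_add, mul_add, add_mul, hx, hy]; ring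

end deriv

section int

variable (d : Derivation C R R) (hQ : ∀ f, Q (d (Q f)) = Q f)

lemma intMap_tens (f : R) (c₁ : C1 Q) (c₂ : C2 C (LinearMap.ker Q))
    (t : TensorAlgebra C (LinearMap.ker Q)) :
    intMap d hQ (ofR Q f * (ofC1 Q c₁ * (ofC2 Q c₂ * ofT Q t))) =
      ofC1 Q c₁ * (ofC2 Q c₂ * intCore d hQ t f) :=
  ext_tens _ _ _ _ _

lemma intMap_ofR_ofT (f : R) (t : TensorAlgebra C (LinearMap.ker Q)) :
    intMap d hQ (ofR Q f * ofT Q t) = intCore d hQ t f := by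
  simpa using intMap_tens d hQ f 1 1 t

lemma derivMap_ofC1_mul (c : C1 Q) (x : IDRAlg Q) :
    derivMap Q d (ofC1 Q c * x) = ofC1 Q c * derivMap Q d x := by
  induction x using induction with
  | tens f c₁ c₂ t =>
    have h : ofC1 Q c * (ofR Q f * (ofC1 Q c₁ * (ofC2 Q c₂ * ofT Q t))) =
        ofR Q f * (ofC1 Q (c * c₁) * (ofC2 Q c₂ * ofT Q t)) := by rw [map_mul]; ring
    rw [h, derivMap_tens, derivMap_tens, map_mul, mul_assoc]
  | add x y hx hy => rw [mul_add, map_add, map_add, mul_add, hx, hy]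

lemma derivMap_ofC2_mul (c : C2 C (LinearMap.ker Q)) (x : IDRAlg Q) :
    derivMap Q d (ofC2 Q c * x) = ofC2 Q c * derivMap Q d x := by
  induction x using induction with
  | tens f c₁ c₂ t =>
    have h : ofC2 Q c * (ofR Q f * (ofC1 Q c₁ * (ofC2 Q c₂ * ofT Q t))) =
        ofR Q f * (ofC1 Q c₁ * (ofC2 Q (c * c₂) * ofT Q t)) := by rw [map_mul]; ring
    rw [h, derivMap_tens, derivMap_tens, map_mul]
    ring
  | add x y hx hy => rw [mul_add, map_add, map_add, mul_add, hx, hy]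

lemma intMap_ofC1_mul (c : C1 Q) (x : IDRAlg Q) :
    intMap d hQ (ofC1 Q c * x) = ofC1 Q c * intMap d hQ x := by
  induction x using induction with
  | tens f c₁ c₂ t =>
    have h : ofC1 Q c * (ofR Q f * (ofC1 Q c₁ * (ofC2 Q c₂ * ofT Q t))) =
        ofR Q f * (ofC1 Q (c * c₁) * (ofC2 Q c₂ * ofT Q t)) := by rw [map_mul]; ring
    rw [h, intMap_tens, intMap_tens, map_mul, mul_assoc]
  | add x y hx hy => rw [mul_add, map_add, map_add, mul_add, hx, hy]

lemma intMap_ofC2_mul (c : C2 C (LinearMap.ker Q)) (x : IDRAlg Q) :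
    intMap d hQ (ofC2 Q c * x) = ofC2 Q c * intMap d hQ x := by
  induction x using induction with
  | tens f c₁ c₂ t =>
    have h : ofC2 Q c * (ofR Q f * (ofC1 Q c₁ * (ofC2 Q c₂ * ofT Q t))) =
        ofR Q f * (ofC1 Q c₁ * (ofC2 Q (c * c₂) * ofT Q t)) := by rw [map_mul]; ring
    rw [h, intMap_tens, intMap_tens, map_mul]
    ring
  | add x y hx hy => rw [mul_add, map_add, map_add, mul_add, hx, hy]

lemma derivMap_ofR_mul_ofT (f : R) (t : TensorAlgebra C (LinearMap.ker Q)) :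
    derivMap Q d (ofR Q f * ofT Q t) = ofR Q (d f) * ofT Q t + ofR Q f * shift t := by
  simpa using derivMap_tens d f 1 1 t

lemma derivMap_ofR (f : R) : derivMap Q d (ofR Q f) = ofR Q (d f) := by
  simpa [ofT_one] using derivMap_ofR_mul_ofT d f 1

lemma derivMap_ofC1 (c : C1 Q) : derivMap Q d (ofC1 Q c) = 0 := by
  have h1 : derivMap Q d 1 = 0 := by simpa using derivMap_ofR (Q := Q) d 1
  simpa [h1] using derivMap_ofC1_mul d c 1

lemma derivMap_intCore (t : TensorAlgebra C (LinearMap.ker Q)) (f : R) :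
    derivMap Q d (intCore d hQ t f) = ofR Q f * ofT Q t := by
  induction t using cons_induction generalizing f with
  | one =>
    rw [intCore_one, map_add, derivMap_ofR, derivMap_ofT,
      ← mul_one (TensorAlgebra.ι C (projT d hQ f)), shift_cons, ofT_one, coe_projT, map_sub]
    ring
  | cons a t ih =>
    rw [intCore_cons, map_add, map_sub, map_sub, ih, derivMap_ofR_mul_ofT, derivMap_ofC1,
      derivMap_ofT, shift_cons, shift_cons, coe_projT, map_sub, map_mul (ofR Q)]
    ring
  | add x y hx hy => rw [map_add, LinearMap.add_apply, map_add, hx, hy, map_add, mul_add]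
  | smul r x hx => rw [map_smul, LinearMap.smul_apply, map_smul, hx, map_smul, mul_smul_comm]

lemma derivMap_intMap (x : IDRAlg Q) : derivMap Q d (intMap d hQ x) = x := by
  induction x using induction with
  | tens f c₁ c₂ t =>
    rw [intMap_tens, derivMap_ofC1_mul, derivMap_ofC2_mul, derivMap_intCore]
    ring
  | add x y hx hy => rw [map_add, map_add, hx, hy]

lemma intCore_of_ker (t : TensorAlgebra C (LinearMap.ker Q)) (a : LinearMap.ker Q) :
    intCore d hQ t (a : R) = ofT Q (TensorAlgebra.ι C a * t) := by
  have ha : Q (a : R) = 0 := a.2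
  have hT : projT d hQ (a : R) = a := Subtype.ext (by simp [ha])
  have he : ∀ s, eps1 Q (a : R) s = 0 := by
    intro s
    have : Q.rangeRestrict (a : R) = 0 := Subtype.ext ha
    simp [eps1, this]
  induction t using cons_induction with
  | one => rw [intCore_one, ha, hT]; simp
  | cons b t _ => rw [intCore_cons, ha, hT, he]; simp
  | add x y hx hy => rw [map_add, LinearMap.add_apply, hx, hy, mul_add, map_add]
  | smul r x hx => rw [map_smul, LinearMap.smul_apply, hx, mul_smul_comm, map_smul]

lemma intMap_eval_mul (hd : ∀ f, d (Q (d f)) = d f)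
    (hC : ∀ f, d f = 0 → ∃ c, algebraMap C R c = f) (x y : IDRAlg Q) :
    intMap d hQ ((x - intMap d hQ (derivMap Q d x)) * y) =
      (x - intMap d hQ (derivMap Q d x)) * intMap d hQ y := by
  have key : ∀ (f : R) (t : TensorAlgebra C (LinearMap.ker Q)) (y : IDRAlg Q),
      intMap d hQ ((ofR Q f * ofT Q t - intMap d hQ (derivMap Q d (ofR Q f * ofT Q t))) * y) =
        (ofR Q f * ofT Q t - intMap d hQ (derivMap Q d (ofR Q f * ofT Q t))) * intMap d hQ y := by
    intro f t
    obtain ⟨c, hc⟩ := hC (f - Q (d f)) (by rw [map_sub, hd, sub_self])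
    have hc' : ofR Q f - ofR Q (Q (d f)) = algebraMap C _ c := by
      rw [← map_sub, ← hc, AlgHom.commutes]
    have hT : projT d hQ (d f) = 0 := Subtype.ext (by simp [hd])
    induction t using cons_induction with
    | one =>
      intro y
      have : ofR Q f * ofT Q 1 - intMap d hQ (derivMap Q d (ofR Q f * ofT Q 1)) =
          algebraMap C _ c := by
        rw [derivMap_ofR_mul_ofT, shift_one, mul_zero, add_zero, intMap_ofR_ofT, intCore_one, hT,
          ofT_one, map_zero, map_zero, ← hc']
        ring
      rw [this, ← Algebra.smul_def, ← Algebra.smul_def, map_smul]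
    | cons a t _ =>
      intro y
      have : ofR Q f * ofT Q (TensorAlgebra.ι C a * t) -
          intMap d hQ (derivMap Q d (ofR Q f * ofT Q (TensorAlgebra.ι C a * t))) =
          ofC1 Q (eps1 Q (d f) (TensorAlgebra.ι C a * t)) := by
        have hfa : f * a = Q (d f) * a + c • (a : R) := by
          rw [Algebra.smul_def, hc]; ring
        rw [derivMap_ofR_mul_ofT, shift_cons, ← mul_assoc, ← map_mul, map_add, intMap_ofR_ofT,
          intMap_ofR_ofT, intCore_cons, hT, map_zero, zero_mul, map_zero, add_zero, hfa, map_add,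
          map_smul, intCore_of_ker, Algebra.smul_def, ← hc']
        ring
      rw [this, intMap_ofC1_mul]
    | add s t hs ht =>
      intro y
      simp only [map_add, mul_add, add_mul, add_sub_add_comm, hs, ht]
    | smul r t ht =>
      intro y
      simp only [map_smul, mul_smul_comm, ← smul_sub, smul_mul_assoc, ht]
  induction x using induction generalizing y with
  | tens f c₁ c₂ t =>
    have : ofR Q f * (ofC1 Q c₁ * (ofC2 Q c₂ * ofT Q t)) -
        intMap d hQ (derivMap Q d (ofR Q f * (ofC1 Q c₁ * (ofC2 Q c₂ * ofT Q t)))) =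
        ofC1 Q c₁ * (ofC2 Q c₂ *
          (ofR Q f * ofT Q t - intMap d hQ (derivMap Q d (ofR Q f * ofT Q t)))) := by
      rw [show ofR Q f * (ofC1 Q c₁ * (ofC2 Q c₂ * ofT Q t)) =
        ofC1 Q c₁ * (ofC2 Q c₂ * (ofR Q f * ofT Q t)) by ring, derivMap_ofC1_mul,
        derivMap_ofC2_mul, intMap_ofC1_mul, intMap_ofC2_mul]
      ring
    rw [this, mul_assoc, mul_assoc, intMap_ofC1_mul, intMap_ofC2_mul, key, mul_assoc, mul_assoc]
  | add x z hx hz => simp only [map_add, add_mul, add_sub_add_comm, hx, hz]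

lemma intMap_const_mul (hd : ∀ f, d (Q (d f)) = d f)
    (hC : ∀ f, d f = 0 → ∃ c, algebraMap C R c = f) (x y : IDRAlg Q) (hx : derivMap Q d x = 0) :
    intMap d hQ (x * y) = x * intMap d hQ y := by
  simpa [hx] using intMap_eval_mul d hQ hd hC x y

/-! The derivation and the integration on tensors `f ⊗ c₁ ⊗ c₂ ⊗ t`. -/

lemma derivMap_tens_one (f : R) (c₁ : C1 Q) (c₂ : C2 C (LinearMap.ker Q)) :
    derivMap Q d (tens Q f c₁ c₂ 1) = tens Q (d f) c₁ c₂ 1 := by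
  rw [tens_eq, tens_eq, derivMap_tens, shift_one]
  ring

lemma derivMap_tens_cons (f : R) (c₁ : C1 Q) (c₂ : C2 C (LinearMap.ker Q))
    (a : LinearMap.ker Q) (t : TensorAlgebra C (LinearMap.ker Q)) :
    derivMap Q d (tens Q f c₁ c₂ (TensorAlgebra.ι C a * t)) =
      tens Q (d f) c₁ c₂ (TensorAlgebra.ι C a * t) + tens Q (f * a) c₁ c₂ t := by
  rw [tens_eq, tens_eq, tens_eq, derivMap_tens, shift_cons, map_mul (ofR Q)]
  ring

lemma intMap_tens_one (f : R) (c₁ : C1 Q) (c₂ : C2 C (LinearMap.ker Q)) :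
    intMap d hQ (tens Q f c₁ c₂ 1) =
      tens Q (Q f) c₁ c₂ 1 + tens Q 1 c₁ c₂ (TensorAlgebra.ι C (projT d hQ f)) := by
  rw [tens_eq, tens_eq, tens_eq, intMap_tens, intCore_one, ofT_one, map_one]
  ring

lemma intMap_tens_cons (f : R) (c₁ : C1 Q) (c₂ : C2 C (LinearMap.ker Q))
    (a : LinearMap.ker Q) (t : TensorAlgebra C (LinearMap.ker Q)) :
    intMap d hQ (tens Q f c₁ c₂ (TensorAlgebra.ι C a * t)) =
      tens Q (Q f) c₁ c₂ (TensorAlgebra.ι C a * t) -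
        tens Q 1 (c₁ * eps1 Q f (TensorAlgebra.ι C a * t)) c₂ 1 -
        intMap d hQ (tens Q (Q f * a) c₁ c₂ t) +
        tens Q 1 c₁ c₂ (TensorAlgebra.ι C (projT d hQ f) * (TensorAlgebra.ι C a * t)) := by
  simp only [tens_eq, intMap_tens, intCore_cons, map_one, ofT_one, map_mul (ofC1 Q)]
  ring

end int

end IDRAlg

end IntegroDiff

/-! ### Differential, integro-differential and quasi-integro-differential rings -/

/-- The ring of constants of a differential ring. -/
def constants (R : Type*) [CommRing R] [Differential R] : Subring R where
  carrier := {f | f′ = 0}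
  mul_mem' {f g} (hf : (f′) = 0) (hg : (g′) = 0) := show (f * g)′ = 0 by simp [hf, hg]
  one_mem' := show (1 : R)′ = 0 by simp
  add_mem' {f g} (hf : (f′) = 0) (hg : (g′) = 0) := show (f + g)′ = 0 by simp [hf, hg]
  zero_mem' := show (0 : R)′ = 0 by simp
  neg_mem' {f} (hf : (f′) = 0) := show (-f)′ = 0 by simp [hf]

/-- The derivation of a differential ring, as a derivation that is linear over the constants. -/
def derivOverConstants (R : Type*) [CommRing R] [Differential R] :
    Derivation (constants R) R R :=
  Derivation.mk'
    { toFun := fun f => (f′)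
      map_add' := fun f g => map_add _ f g
      map_smul' := fun c f => by
        have hc : (c : R)′ = 0 := c.2
        simp [Subring.smul_def, hc] }
    (fun f g => by simp)

lemma derivOverConstants_apply {R : Type*} [CommRing R] [Differential R] (f : R) :
    derivOverConstants R f = (f′) := rfl

/-- A commutative integro-differential ring: a commutative differential ring with an integration
`∫`, linear over the constants and right inverse to the derivation. -/
class IntegroDifferentialRing (S : Type*) [CommRing S] extends Differential S where
  /-- The integration. -/
  int : S →ₗ[constants S] S
  deriv_int : ∀ f : S, (int f)′ = f

/-- A commutative quasi-integro-differential ring: a commutative differential ring with a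
quasi-integration `Q`, linear over the constants, such that `∂Q∂ = ∂` and `Q∂Q = Q`. -/
class QuasiIntegroDifferentialRing (R : Type*) [CommRing R] extends Differential R where
  /-- The quasi-integration. -/
  Q : R →ₗ[constants R] R
  deriv_Q_deriv : ∀ f : R, (Q (f′))′ = (f′)
  Q_deriv_Q : ∀ f : R, Q ((Q f)′) = Q f

/-- A ring homomorphism between differential rings that commutes with the derivations. -/
def IsDifferentialHom {R S : Type*} [CommRing R] [CommRing S] [Differential R] [Differential S]
    (φ : R →+* S) : Prop :=
  ∀ f, φ (f′) = (φ f)′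

/-- A ring homomorphism between integro-differential rings that commutes with the derivations and
with the integrations. -/
def IsIntegroDifferentialHom {A B : Type*} [CommRing A] [CommRing B] [IntegroDifferentialRing A]
    [IntegroDifferentialRing B] (η : A →+* B) : Prop :=
  IsDifferentialHom η ∧
    ∀ x, η (IntegroDifferentialRing.int x) = IntegroDifferentialRing.int (η x)

/-- The free commutative integro-differential ring `IDR_Q(R) = R ⊗ C̃₁ ⊗ C₂ ⊗ T` on the commutative
quasi-integro-differential ring `(R, ∂, Q)`; tensor products are taken over the constants of `R`. -/
def IDRQ (R : Type*) [CommRing R] [QuasiIntegroDifferentialRing R] : Type _ :=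
  IntegroDiff.IDRAlg (QuasiIntegroDifferentialRing.Q (R := R))

namespace IDRQ

open IntegroDiff QuasiIntegroDifferentialRing

variable (R : Type*) [CommRing R] [QuasiIntegroDifferentialRing R]

lemma Q_derivOverConstants_Q (f : R) : Q (derivOverConstants R (Q f)) = Q f := Q_deriv_Q f

lemma derivOverConstants_Q (f : R) :
    derivOverConstants R (Q (derivOverConstants R f)) = derivOverConstants R f := deriv_Q_deriv f

instance : CommRing (IDRQ R) := inferInstanceAs (CommRing (IDRAlg (Q (R := R))))

instance : Algebra (constants R) (IDRQ R) :=
  inferInstanceAs (Algebra (constants R) (IDRAlg (Q (R := R))))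

/-- The derivation of `IDR_Q(R)` as a map. -/
def derivFun (x : IDRQ R) : IDRQ R := IDRAlg.derivMap (Q (R := R)) (derivOverConstants R) x

/-- The integration of `IDR_Q(R)` as a map. -/
def intFun (x : IDRQ R) : IDRQ R :=
  IDRAlg.intMap (Q := Q (R := R)) (derivOverConstants R) (Q_derivOverConstants_Q R) x

lemma derivFun_add (x y : IDRQ R) : derivFun R (x + y) = derivFun R x + derivFun R y :=
  map_add (IDRAlg.derivMap (Q (R := R)) (derivOverConstants R)) x y

lemma derivFun_mul (x y : IDRQ R) :
    derivFun R (x * y) = x * derivFun R y + y * derivFun R x :=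
  IDRAlg.derivMap_mul (derivOverConstants R) x y

set_option maxRecDepth 20000 in
lemma intFun_add (x y : IDRQ R) : intFun R (x + y) = intFun R x + intFun R y := by
  unfold intFun
  exact map_add (IDRAlg.intMap (Q := Q (R := R)) (derivOverConstants R) (Q_derivOverConstants_Q R)) x y

set_option maxRecDepth 20000 in
lemma derivFun_intFun (x : IDRQ R) : derivFun R (intFun R x) = x := by
  unfold derivFun intFun
  exact IDRAlg.derivMap_intMap (Q := Q (R := R)) (derivOverConstants R) (Q_derivOverConstants_Q R) x

set_option maxRecDepth 20000 in
lemma intFun_const_mul (c x : IDRQ R) (hc : derivFun R c = 0) :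
    intFun R (c * x) = c * intFun R x := by
  unfold intFun
  exact IDRAlg.intMap_const_mul (Q := Q (R := R)) (derivOverConstants R) (Q_derivOverConstants_Q R)
    (derivOverConstants_Q R) (fun f hf => ⟨⟨f, hf⟩, rfl⟩) c x hc

instance : Differential (IDRQ R) where
  deriv := Derivation.mk' (AddMonoidHom.toIntLinearMap (AddMonoidHom.mk' (derivFun R)
    (derivFun_add R))) (derivFun_mul R)

lemma deriv_apply (x : IDRQ R) : (x′) = derivFun R x := rfl

instance : IntegroDifferentialRing (IDRQ R) where
  int :=
    { toFun := intFun R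
      map_add' := intFun_add R
      map_smul' := fun c x => intFun_const_mul R c x c.2 }
  deriv_int := derivFun_intFun R

lemma int_apply (x : IDRQ R) : IntegroDifferentialRing.int x = intFun R x := rfl

/-- The canonical homomorphism `ι(f) = f ⊗ 1 ⊗ 1 ⊗ 1`. -/
def ι : R →+* IDRQ R := (IDRAlg.ofR (Q (R := R))).toRingHom

end IDRQ

end

/-! In an integro-differential ring the evaluation `E x = x - ∫ ∂x` takes constant values, is linear
over the constants and kills integrals, but it need not be multiplicative. The algebras `C̃₁` and
`C₂` record the values of `E` on products, and the theorem says that they impose nothing beyond what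
holds in every `S`.

Existence. Each letter of `R_T` is sent to its image under `φ`, and each tensor to the corresponding
nested integral. Writing a product of two nested integrals as `x = ∫ ∂x + E x`, applying the Leibniz
rule and inducting on the lengths gives the expansion `nested_mul_nested`: shuffles of prefixes
weighted by evaluations of products of suffixes. This is the product of `C₂ ⊗ T` with `ε(x ⊙ y)`
read as `E` of a product. The relations defining `C₂` hold in `S` because they compare the two
expansions of `E(FGH)` that come from the two bracketings (`evalSym_constRel`). The algebra `C̃₁` is
free, so `ε(Qf ⊗ t)` may be sent to `E` of the product of `φ(Qf)` with the nested integral of `t`.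
The homomorphism obtained on the triple tensor product respects `∂` because both algebras of
coefficients land in constants. It respects `∫` because the recursive definition of `∫` is
integration by parts: `f` splits as `∂Qf + (f - ∂Qf)`, the boundary term is the generator of `C̃₁`,
and the hypothesis on `φ` says `E(φ(Qf)) = 0` (`liftHom_intCore`).

Uniqueness. Prepending a letter is an integration, so the values on `T` are determined by those on
`R`. The integration recursion can then be solved for the generators of `C̃₁`, and the product
recursion for the generators of `C₂` (`algHom_ext_of_intMap`). -/

noncomputable section

namespace NestedIntegral

open Shuffle

variable {C S M : Type*} [CommRing C] [CommRing S] [Algebra C S] [AddCommGroup M] [Module C M]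

/-! ### The evaluation attached to an integration. -/

section evaluation

variable (D : Derivation C S S) (I : S →ₗ[C] S)

/-- The evaluation `x ↦ x - ∫ ∂x`. -/
def evaluation : S →ₗ[C] S := LinearMap.id - I ∘ₗ D.toLinearMap

lemma evaluation_apply (x : S) : evaluation D I x = x - I (D x) := rfl

lemma evaluation_one : evaluation D I 1 = 1 := by simp [evaluation_apply]

variable {D I}

lemma deriv_evaluation (hDI : ∀ x, D (I x) = x) (x : S) : D (evaluation D I x) = 0 := by
  rw [evaluation_apply, map_sub, hDI, sub_self]

lemma evaluation_int (hDI : ∀ x, D (I x) = x) (x : S) : evaluation D I (I x) = 0 := by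
  rw [evaluation_apply, hDI, sub_self]

/-- Linearity over the image of `C` is not enough: the coefficients in product expansions are
evaluations, which are constants of `S` that need not come from `C`. -/
lemma evaluation_const_mul (hI : ∀ c x, D c = 0 → I (c * x) = c * I x) {c : S} (hc : D c = 0)
    (x : S) : evaluation D I (c * x) = c * evaluation D I x := by
  rw [evaluation_apply, evaluation_apply, D.leibniz, hc, smul_zero, add_zero, smul_eq_mul, hI c _ hc,
    mul_sub]

lemma eq_int_add_evaluation (x : S) : x = I (D x) + evaluation D I x := by
  rw [evaluation_apply]; ring

end evaluation

/-! ### Nested integrals and the expansion of their products. -/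

section nested

variable (I : S →ₗ[C] S) (w : M →ₗ[C] S)

/-- The nested integrals: `1 ↦ 1` and `a ⊗ t ↦ ∫ (w a) · nested t`. -/
def nested : TensorAlgebra C M →ₗ[C] S :=
  primRec 1 (LinearMap.mk₂ C (fun a p => I (w a * p.2))
    (by intros; simp [add_mul]) (by intros; simp)
    (by intros; simp [mul_add]) (by intros; simp))

@[simp] lemma nested_one : nested I w 1 = 1 := by simp [nested]

@[simp] lemma nested_cons (a : M) (t : TensorAlgebra C M) :
    nested I w (TensorAlgebra.ι C a * t) = I (w a * nested I w t) := by simp [nested]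

variable (D : Derivation C S S)

/-- The evaluation of a product of two nested integrals. -/
def evalMul : TensorAlgebra C M →ₗ[C] TensorAlgebra C M →ₗ[C] S :=
  ((LinearMap.mul C S).compl₁₂ (nested I w) (nested I w)).compr₂ (evaluation D I)

lemma evalMul_apply (f g : TensorAlgebra C M) :
    evalMul I w D f g = evaluation D I (nested I w f * nested I w g) := rfl

/-- The bilinear map `(p ⊗ q, r ⊗ s) ↦ evalMul p r · nested (q ⧢ s)`. -/
def splitMul : TensorAlgebra C M ⊗[C] TensorAlgebra C M →ₗ[C]
    TensorAlgebra C M ⊗[C] TensorAlgebra C M →ₗ[C] S :=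
  (TensorProduct.map₂ (evalMul I w D) (shuffle.compr₂ (nested I w))).compr₂
    (LinearMap.mul' C S)

lemma splitMul_tmul (p q r s : TensorAlgebra C M) :
    splitMul I w D (p ⊗ₜ q) (r ⊗ₜ s) = evalMul I w D p r * nested I w (shuffle q s) := rfl

variable {I D} (hDI : ∀ x, D (I x) = x) (hI : ∀ c x, D c = 0 → I (c * x) = c * I x)

include hDI

/-- The coefficients of the product expansion are constants, which is what lets `hI` move them
through `I`. -/
lemma deriv_evalMul (f g : TensorAlgebra C M) : D (evalMul I w D f g) = 0 :=
  deriv_evaluation hDI _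

/-- A tensor of positive length gives an integral, which evaluation kills; only the degree zero part
survives. -/
lemma evaluation_nested (t : TensorAlgebra C M) :
    evaluation D I (nested I w t) = algebraMap C S (TensorAlgebra.algebraMapInv t) := by
  induction t using cons_induction with
  | one => simp [evaluation_one]
  | cons a t _ => rw [nested_cons, evaluation_int hDI, aug_cons, map_zero]
  | add x y hx hy => simp only [map_add, hx, hy]
  | smul c x hx => rw [map_smul, map_smul, hx, map_smul, smul_eq_mul, map_mul, Algebra.smul_def]

include hI

/-- The shuffle recursion carried over to `S`: the first letter of a shuffle comes from one of the
two prefixes and becomes the outermost integral, while the suffix coefficient, being constant,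
passes through `I`. -/
lemma splitMul_prep_prep (a b : M) (d e : TensorAlgebra C M ⊗[C] TensorAlgebra C M) :
    splitMul I w D (prep a d) (prep b e) =
      I (w a * splitMul I w D d (prep b e)) + I (w b * splitMul I w D (prep a d) e) := by
  induction d with
  | zero => simp
  | tmul p q =>
    induction e with
    | zero => simp
    | tmul r s =>
      simp only [prep_tmul, splitMul_tmul, shuffle_cons_cons, map_add, nested_cons, mul_add,
        mul_left_comm _ (evalMul I w D p r), hI _ _ (deriv_evalMul w hDI p r)]
    | add x y hx hy => simp only [map_add, mul_add, hx, hy]; abel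
  | add x y hx hy => simp only [map_add, mul_add, LinearMap.add_apply, hx, hy]; abel

lemma splitMul_prep_one (a : M) (d : TensorAlgebra C M ⊗[C] TensorAlgebra C M)
    (x : TensorAlgebra C M) :
    splitMul I w D (prep a d) (x ⊗ₜ 1) = I (w a * splitMul I w D d (x ⊗ₜ 1)) := by
  induction d with
  | zero => simp
  | tmul p q =>
    simp only [prep_tmul, splitMul_tmul, shuffle_one, nested_cons,
      mul_left_comm _ (evalMul I w D p x), hI _ _ (deriv_evalMul w hDI p x)]
  | add x y hx hy => simp only [map_add, mul_add, LinearMap.add_apply, hx, hy]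

lemma splitMul_one_prep (a : M) (d : TensorAlgebra C M ⊗[C] TensorAlgebra C M)
    (x : TensorAlgebra C M) :
    splitMul I w D (x ⊗ₜ 1) (prep a d) = I (w a * splitMul I w D (x ⊗ₜ 1) d) := by
  induction d with
  | zero => simp
  | tmul p q =>
    simp only [prep_tmul, splitMul_tmul, one_shuffle, nested_cons,
      mul_left_comm _ (evalMul I w D x p), hI _ _ (deriv_evalMul w hDI x p)]
  | add x y hx hy => simp only [map_add, mul_add, hx, hy]

/-- The base case of the product formula: against the empty tensor every nonempty suffix evaluates
to zero, so only the full prefix remains. -/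
lemma splitMul_one_left (t : TensorAlgebra C M) :
    splitMul I w D (1 ⊗ₜ 1) (decon t) = nested I w t := by
  induction t using cons_induction with
  | one => simp [splitMul_tmul, evalMul_apply, evaluation_one]
  | cons a t ih =>
    rw [decon_cons, map_add, splitMul_one_prep w hDI hI, ih, splitMul_tmul, evalMul_apply,
      nested_one, one_mul, evaluation_nested w hDI, aug_cons, map_zero, zero_mul, zero_add,
      nested_cons]
  | add x y hx hy => simp only [map_add, hx, hy]
  | smul c x hx => simp only [map_smul, hx]

lemma splitMul_one_right (t : TensorAlgebra C M) :
    splitMul I w D (decon t) (1 ⊗ₜ 1) = nested I w t := by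
  induction t using cons_induction with
  | one => simp [splitMul_tmul, evalMul_apply, evaluation_one]
  | cons a t ih =>
    rw [decon_cons, map_add, LinearMap.add_apply, splitMul_prep_one w hDI hI, ih, splitMul_tmul,
      evalMul_apply, nested_one, mul_one, evaluation_nested w hDI, aug_cons, map_zero, zero_mul,
      zero_add, nested_cons]
  | add x y hx hy => simp only [map_add, LinearMap.add_apply, hx, hy]
  | smul c x hx => simp only [map_smul, LinearMap.smul_apply, hx]

/-- The product of two nested integrals. -/
lemma nested_mul_nested (f g : TensorAlgebra C M) :
    nested I w f * nested I w g = splitMul I w D (decon f) (decon g) := by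
  induction f using cons_induction generalizing g with
  | one => rw [nested_one, one_mul, decon_one, splitMul_one_left w hDI hI]
  | cons a f ihf =>
    induction g using cons_induction with
    | one => rw [nested_one, mul_one, decon_one, splitMul_one_right w hDI hI]
    | cons b g ihg =>
      -- The Leibniz rule strips the outer integral from one factor at a time, leaving products that
      -- the two induction hypotheses expand. The evaluation is the new coefficient, in which
      -- neither tensor is split.
      rw [eq_int_add_evaluation (D := D) (I := I) (nested I w _ * nested I w _), ← evalMul_apply,
        D.leibniz]
      simp only [nested_cons I w b g, nested_cons I w a f, hDI, smul_eq_mul] at ihg ⊢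
      rw [map_add,
        show I (w a * nested I w f) * (w b * nested I w g) =
          w b * (I (w a * nested I w f) * nested I w g) by ring,
        show I (w b * nested I w g) * (w a * nested I w f) =
          w a * (nested I w f * I (w b * nested I w g)) by ring, ihg, ← nested_cons, ihf]
      -- On both sides the splittings separate according to whether each prefix is empty; the pair
      -- of empty prefixes gives the evaluation term.
      simp only [decon_cons, map_add, LinearMap.add_apply, splitMul_prep_prep w hDI hI,
        splitMul_prep_one w hDI hI, splitMul_one_prep w hDI hI, splitMul_tmul, one_shuffle,
        nested_one, mul_one, mul_add]
      abel
    | add x y hx hy => simp only [map_add, mul_add, hx, hy]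
    | smul c x hx => simp only [map_smul, mul_smul_comm, hx]
  | add x y hx hy => simp only [map_add, add_mul, LinearMap.add_apply, hx, hy]
  | smul c x hx => simp only [map_smul, smul_mul_assoc, LinearMap.smul_apply, hx]

end nested

end NestedIntegral

end

/-! ### The relations of `C₂` in `S` and the homomorphism on `C₂ ⊗ T`. -/

noncomputable section

namespace NestedIntegral

open Shuffle

variable {C S M : Type*} [CommRing C] [CommRing S] [Algebra C S] [AddCommGroup M] [Module C M]
variable {D : Derivation C S S} {I : S →ₗ[C] S} (w : M →ₗ[C] S)
variable (hDI : ∀ x, D (I x) = x) (hI : ∀ c x, D c = 0 → I (c * x) = c * I x)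

section formula

include hDI

lemma evalMul_one_left_pureTensor {f : List M} (hf : f ≠ []) :
    evalMul I w D 1 (pureTensor C M f) = 0 := by
  rw [evalMul_apply, nested_one, one_mul, evaluation_nested w hDI,
    GenShuffle.aug_pureTensor hf, map_zero]

lemma evalMul_one_right_pureTensor {f : List M} (hf : f ≠ []) :
    evalMul I w D (pureTensor C M f) 1 = 0 := by
  rw [evalMul_apply, nested_one, mul_one, evaluation_nested w hDI,
    GenShuffle.aug_pureTensor hf, map_zero]

include hI

/-- Among all splittings, the one with both suffixes empty has coefficient `1` and gives the pure
shuffle; those with exactly one empty suffix have coefficient zero. -/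
lemma nested_pureTensor_mul (f g : List M) :
    nested I w (pureTensor C M f) * nested I w (pureTensor C M g) =
      nested I w (shuffle (pureTensor C M f) (pureTensor C M g)) +
        ∑ j ∈ Finset.range g.length, ∑ i ∈ Finset.range f.length,
          evalMul I w D (pureTensor C M (f.drop i)) (pureTensor C M (g.drop j)) *
            nested I w (shuffle (pureTensor C M (f.take i)) (pureTensor C M (g.take j))) := by
  rw [nested_mul_nested w hDI hI, decon_pureTensor, decon_pureTensor]
  simp only [map_sum, LinearMap.sum_apply, splitMul_tmul]
  rw [Finset.sum_range_succ, add_comm]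
  congr 1
  · rw [Finset.sum_range_succ, Finset.sum_eq_zero, zero_add]
    · simp [evalMul_apply, evaluation_one]
    · intro i hi
      rw [List.drop_length, pureTensor_nil, evalMul_one_right_pureTensor w hDI (by simpa using hi),
        zero_mul]
  · refine Finset.sum_congr rfl fun j hj => ?_
    rw [Finset.sum_range_succ, List.drop_length, pureTensor_nil,
      evalMul_one_left_pureTensor w hDI (by simpa using hj), zero_mul, add_zero]

/-- The free factor `y` is the third factor in the associativity argument of `evalSym_constRel`. -/
lemma evaluation_nested_mul_mul (f g : List M) (y : S) :
    evaluation D I (nested I w (pureTensor C M f) * nested I w (pureTensor C M g) * y) =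
      evaluation D I (nested I w (shuffle (pureTensor C M f) (pureTensor C M g)) * y) +
        ∑ j ∈ Finset.range g.length, ∑ i ∈ Finset.range f.length,
          evalMul I w D (pureTensor C M (f.drop i)) (pureTensor C M (g.drop j)) *
            evaluation D I
              (nested I w (shuffle (pureTensor C M (f.take i)) (pureTensor C M (g.take j))) * y) := by
  rw [nested_pureTensor_mul w hDI hI, add_mul, map_add, Finset.sum_mul, map_sum]
  simp only [Finset.sum_mul, map_sum, mul_assoc,
    evaluation_const_mul hI (deriv_evalMul w hDI _ _)]

end formula

variable (D I) in
/-- The evaluation of products on the symmetric square. -/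
def evalSq : SymSquare C (posPart C M) →ₗ[C] S :=
  Submodule.liftQ _ (TensorProduct.lift
    ((evalMul I w D).compl₁₂ (posPart C M).subtype (posPart C M).subtype)) (by
      rw [Submodule.span_le]
      rintro _ ⟨x, y, rfl⟩
      simp [evalMul_apply, mul_comm])

variable (D I) in
/-- The homomorphism `ε(x ⊙ y) ↦ evalMul x y`. -/
def evalSym : SymC2 C M →ₐ[C] S := SymmetricAlgebra.lift (evalSq D I w)

lemma evalSym_epsSym' (x y : TensorAlgebra C M) :
    evalSym D I w (epsSym C M x y) = evalMul I w D (posProj C M x) (posProj C M y) :=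
  SymmetricAlgebra.lift_ι_apply _ _

include hDI in
-- `epsSym` discards the scalar parts `a`, `b` of its arguments. Expanding `E((X - a)(Y - b))` with
-- `E X = a` and `E Y = b` leaves `E(XY) - ab`.
lemma evalSym_epsSym (x y : TensorAlgebra C M) :
    evalSym D I w (epsSym C M x y) = evalMul I w D x y - algebraMap C S
      (TensorAlgebra.algebraMapInv x * TensorAlgebra.algebraMapInv y) := by
  have h1 (c : C) : nested I w (algebraMap C _ c) = algebraMap C S c := by
    rw [Algebra.algebraMap_eq_smul_one, map_smul, nested_one, Algebra.algebraMap_eq_smul_one]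
  have h2 (c : C) (s : S) : evaluation D I (algebraMap C S c * s) =
      algebraMap C S c * evaluation D I s := by
    rw [← Algebra.smul_def, map_smul, Algebra.smul_def]
  have h3 (c : C) : evaluation D I (algebraMap C S c) = algebraMap C S c := by
    simpa [evaluation_one] using h2 c 1
  rw [evalSym_epsSym', evalMul_apply, evalMul_apply, coe_posProj, coe_posProj, map_sub, map_sub,
    h1, h1, sub_mul, mul_sub, mul_sub, mul_comm (nested I w x) (algebraMap C S _)]
  simp only [map_sub, h2, h3, evaluation_nested w hDI, map_mul]
  ring

/-- With truncated subtraction the lower bound `1 - j` omits only the pair `i = j = 0`. -/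
lemma sum_Ico_one_sub {A : Type*} [AddCommMonoid A] {F : ℕ → ℕ → A} (h0 : F 0 0 = 0) (n j : ℕ) :
    ∑ i ∈ Finset.Ico (1 - j) n, F i j = ∑ i ∈ Finset.range n, F i j := by
  refine Finset.sum_subset (fun i hi => by simp at hi ⊢; omega) fun i hi hi' => ?_
  simp only [Finset.mem_range, Finset.mem_Ico, not_and] at hi hi'
  have : i = 0 ∧ j = 0 := by
    constructor <;> by_contra hne <;> exact hi' (by omega) hi
  rw [this.1, this.2, h0]

include hDI hI in
-- Associativity in `S`: for the nested integrals `F`, `G`, `H` of the three tensors, expand `FG` in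
-- `E((FG)H)` and `GH` in `E(F(GH))`. The difference of the two expansions is the relation.
lemma evalSym_constRel {f g h : List M} (hf : f ≠ []) (hh : h ≠ []) :
    evalSym D I w (constRel C M f g h) = 0 := by
  -- Every `ε` in the relation has a nonempty pure tensor as one of its arguments, so the correction
  -- term of `evalSym_epsSym` always vanishes.
  have hr : ∀ {p : List M}, p ≠ [] → ∀ x, evalSym D I w (epsSym C M x (pureTensor C M p)) =
      evalMul I w D x (pureTensor C M p) := fun hp x => by
    rw [evalSym_epsSym w hDI, GenShuffle.aug_pureTensor hp, mul_zero, map_zero, sub_zero]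
  have hl : ∀ {p : List M}, p ≠ [] → ∀ x, evalSym D I w (epsSym C M (pureTensor C M p) x) =
      evalMul I w D (pureTensor C M p) x := fun hp x => by
    rw [evalSym_epsSym w hDI, GenShuffle.aug_pureTensor hp, zero_mul, map_zero, sub_zero]
  have key := evaluation_nested_mul_mul w hDI hI f g (nested I w (pureTensor C M h))
  -- The second bracketing is rewritten as `(HG)F`, so that the same expansion lemma applies with
  -- `F` as the free factor.
  rw [mul_assoc, mul_comm, mul_comm (nested I w (pureTensor C M g)),
    evaluation_nested_mul_mul w hDI hI h g] at key
  simp only [← evalMul_apply] at key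
  have h1 : ∀ j ∈ Finset.range g.length,
      evalSym D I w ((∑ i ∈ Finset.Ico (1 - j) f.length,
          epsSym C M (pureTensor C M (f.drop i)) (pureTensor C M (g.drop j)) *
            epsSym C M (shuffle (pureTensor C M (f.take i)) (pureTensor C M (g.take j)))
              (pureTensor C M h)) -
        ∑ k ∈ Finset.Ico (1 - j) h.length,
          epsSym C M (pureTensor C M f)
              (shuffle (pureTensor C M (g.take j)) (pureTensor C M (h.take k))) *
            epsSym C M (pureTensor C M (g.drop j)) (pureTensor C M (h.drop k))) =
      (∑ i ∈ Finset.range f.length,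
          evalMul I w D (pureTensor C M (f.drop i)) (pureTensor C M (g.drop j)) *
            evalMul I w D (shuffle (pureTensor C M (f.take i)) (pureTensor C M (g.take j)))
              (pureTensor C M h)) -
        ∑ k ∈ Finset.range h.length,
          evalMul I w D (pureTensor C M (h.drop k)) (pureTensor C M (g.drop j)) *
          evalMul I w D (shuffle (pureTensor C M (h.take k)) (pureTensor C M (g.take j)))
              (pureTensor C M f) := by
    intro j hj
    have hj' : g.drop j ≠ [] := by simpa using hj
    simp only [map_sub, map_sum, map_mul, hr hh, hl hf, hr hj', hl hj']
    congr 1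
    · refine sum_Ico_one_sub (F := fun i j =>
        evalMul I w D (pureTensor C M (f.drop i)) (pureTensor C M (g.drop j)) *
            evalMul I w D (shuffle (pureTensor C M (f.take i)) (pureTensor C M (g.take j)))
              (pureTensor C M h)) ?_ _ j
      -- For `i = j = 0` the shuffle of prefixes is `1`, and the evaluation of a nested integral of
      -- positive length is zero.
      simp [evalMul_one_left_pureTensor w hDI hh]
    · rw [← sum_Ico_one_sub (F := fun k j =>
        evalMul I w D (pureTensor C M (h.drop k)) (pureTensor C M (g.drop j)) *
          evalMul I w D (shuffle (pureTensor C M (h.take k)) (pureTensor C M (g.take j)))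
              (pureTensor C M f)) (by simp [evalMul_one_left_pureTensor w hDI hf]) _ j]
      refine Finset.sum_congr rfl fun k _ => ?_
      rw [mul_comm, shuffle_comm (pureTensor C M (g.take j))]
      simp only [evalMul_apply, mul_comm]
  rw [constRel, map_add, map_sub, map_sum, hr hh, hl hf, Finset.sum_congr rfl h1,
    Finset.sum_sub_distrib, evalMul_apply I w D (pureTensor C M f),
    mul_comm (nested I w (pureTensor C M f)), ← evalMul_apply, shuffle_comm (pureTensor C M g)]
  linear_combination -key

/-- The homomorphism `C₂ → S` with `ε(x ⊙ y) ↦ evalMul x y`. -/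
def evalC2 : C2 C M →ₐ[C] S :=
  Ideal.Quotient.liftₐ (constIdeal C M) (evalSym D I w) (fun r hr => by
    have : constIdeal C M ≤ RingHom.ker (evalSym D I w) := by
      rw [constIdeal, Ideal.span_le]
      rintro _ ⟨f, g, h, hf, -, hh, rfl⟩
      exact evalSym_constRel w hDI hI hf hh
    exact this hr)

lemma evalC2_eps (x y : TensorAlgebra C M) : evalC2 w hDI hI (eps C M x y) =
    evalMul I w D x y - algebraMap C S
      (TensorAlgebra.algebraMapInv x * TensorAlgebra.algebraMapInv y) :=
  evalSym_epsSym w hDI x y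

/-- The convention for `ε` on empty tensors agrees with evaluation in `S`: the degree zero term
added in `epsExt` is the one subtracted in `evalC2_eps`. -/
lemma evalC2_epsExt (x y : TensorAlgebra C M) : evalC2 w hDI hI (epsExt C M x y) =
    evalMul I w D x y := by
  rw [GenShuffle.epsExt_apply, map_add, evalC2_eps, map_mul (evalC2 w hDI hI), AlgHom.commutes,
    AlgHom.commutes, map_mul (algebraMap C S), sub_add_cancel]

/-- The kernel of a `C`-derivation is a subalgebra, so checking generators suffices. This makes the
images of both `C̃₁` and `C₂` consist of constants. -/
lemma deriv_lift_eq_zero {N : Type*} [AddCommMonoid N] [Module C N] (F : N →ₗ[C] S)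
    (h : ∀ n, D (F n) = 0) (a : SymmetricAlgebra C N) : D (SymmetricAlgebra.lift F a) = 0 := by
  induction a using SymmetricAlgebra.induction with
  | algebraMap r => rw [AlgHom.commutes, D.map_algebraMap]
  | ι x => rw [SymmetricAlgebra.lift_ι_apply, h]
  | add x y hx hy => rw [map_add, map_add, hx, hy, add_zero]
  | mul x y hx hy => rw [map_mul, D.leibniz, hx, hy, smul_zero, smul_zero, add_zero]

lemma deriv_evalC2 (c : C2 C M) : D (evalC2 w hDI hI c) = 0 := by
  obtain ⟨c, rfl⟩ := Ideal.Quotient.mk_surjective c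
  refine deriv_lift_eq_zero (evalSq D I w) (fun n => ?_) c
  obtain ⟨n, rfl⟩ := Submodule.Quotient.mk_surjective _ n
  change D (TensorProduct.lift _ n) = 0
  induction n with
  | zero => simp
  | tmul x y => exact deriv_evalMul w hDI _ _
  | add x y hx hy => rw [map_add, map_add, hx, hy, add_zero]

/-- The linear map `c ⊗ t ↦ evalC2 c · nested t`. -/
def genShuffleLin : GenShuffle C M →ₗ[C] S :=
  show C2 C M ⊗[C] TensorAlgebra C M →ₗ[C] S from
    TensorProduct.lift ((LinearMap.mul C S).compl₁₂ (evalC2 w hDI hI).toLinearMap (nested I w))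

lemma genShuffleLin_smul_of (c : C2 C M) (t : TensorAlgebra C M) :
    genShuffleLin w hDI hI (c • GenShuffle.of C M t) = evalC2 w hDI hI c * nested I w t := by
  rw [GenShuffle.smul_of]; rfl

lemma genShuffleLin_of (t : TensorAlgebra C M) :
    genShuffleLin w hDI hI (GenShuffle.of C M t) = nested I w t := by
  simpa using genShuffleLin_smul_of w hDI hI 1 t

lemma genShuffleLin_smul (c : C2 C M) (u : GenShuffle C M) :
    genShuffleLin w hDI hI (c • u) = evalC2 w hDI hI c * genShuffleLin w hDI hI u := by
  induction u using GenShuffle.induction with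
  | smul_of d t =>
    rw [smul_smul, genShuffleLin_smul_of, genShuffleLin_smul_of, map_mul, mul_assoc]
  | add x y hx hy => rw [smul_add, map_add, map_add, hx, hy, mul_add]

/-- Before composition with deconcatenation, the product of `C₂ ⊗ T` and the product expansion in
`S` correspond term by term; multiplicativity then reduces to `nested_mul_nested`. -/
lemma genShuffleLin_mm (d e : TensorAlgebra C M ⊗[C] TensorAlgebra C M) :
    genShuffleLin w hDI hI (GenShuffle.mm d e) = splitMul I w D d e := by
  induction d with
  | zero => simp
  | tmul p q =>
    induction e with
    | zero => simp
    | tmul r s =>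
      rw [GenShuffle.mm_tmul, genShuffleLin_smul_of, evalC2_epsExt, splitMul_tmul]
    | add x y hx hy => simp only [map_add, hx, hy]
  | add x y hx hy => simp only [map_add, LinearMap.add_apply, hx, hy]

lemma genShuffleLin_mul (x y : GenShuffle C M) :
    genShuffleLin w hDI hI (x * y) = genShuffleLin w hDI hI x * genShuffleLin w hDI hI y := by
  induction x using GenShuffle.induction with
  | smul_of c f =>
    induction y using GenShuffle.induction with
    | smul_of d g =>
      rw [GenShuffle.mul_def, GenShuffle.mulAux_smul_of, genShuffleLin_smul, GenShuffle.mulT_eq_mm,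
        genShuffleLin_mm, ← nested_mul_nested w hDI hI, genShuffleLin_smul_of,
        genShuffleLin_smul_of, map_mul]
      ring
    | add x y hx hy => rw [mul_add, map_add, map_add, hx, hy, mul_add]
  | add x y hx hy => rw [add_mul, map_add, map_add, hx, hy, add_mul]

/-- The homomorphism `C₂ ⊗ T → S` with `c ⊗ t ↦ evalC2 c · nested t`. -/
def genShuffleHom : GenShuffle C M →ₐ[C] S :=
  AlgHom.ofLinearMap (genShuffleLin w hDI hI)
    (by rw [GenShuffle.one_def, genShuffleLin_of, nested_one]) (genShuffleLin_mul w hDI hI)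

end NestedIntegral

end

noncomputable section

namespace IntegroDiff

open Shuffle NestedIntegral

namespace IDRAlg

variable {C R S : Type*} [CommRing C] [CommRing R] [Algebra C R] {Q : R →ₗ[C] R}
variable [CommRing S] [Algebra C S] {D : Derivation C S S} {I : S →ₗ[C] S}

/-! ### Existence: the homomorphism induced by `φ`. -/

section existence

variable (φ : R →ₐ[C] S)

/-- The restriction of `φ` to `R_T`. -/
def letter : LinearMap.ker Q →ₗ[C] S := φ.toLinearMap ∘ₗ (LinearMap.ker Q).subtype

variable (D I) in
/-- The evaluation of `φ(f) · nested t`, as a linear map on `R_J ⊗ T̃`. -/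
def evalTensor : LinearMap.range Q ⊗[C] posPart C (LinearMap.ker Q) →ₗ[C] S :=
  evaluation D I ∘ₗ TensorProduct.lift
    ((LinearMap.mul C S).compl₁₂ (φ.toLinearMap ∘ₗ (LinearMap.range Q).subtype)
      (nested I (letter (Q := Q) φ) ∘ₗ (posPart C (LinearMap.ker Q)).subtype))

variable (D I) in
/-- The homomorphism `C̃₁ → S` with `ε(f ⊗ t) ↦ evalTensor (f ⊗ t)`. -/
def evalC1 : C1 Q →ₐ[C] S :=
  show SymmetricAlgebra C (LinearMap.range Q ⊗[C] posPart C (LinearMap.ker Q)) →ₐ[C] S from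
    SymmetricAlgebra.lift (evalTensor D I φ)

/-- A tensor with a first letter lies in `T̃`, so the projection inside `eps1` leaves it unchanged.
-/
lemma evalC1_eps1_cons (f : R) (a : LinearMap.ker Q) (t : TensorAlgebra C (LinearMap.ker Q)) :
    evalC1 D I φ (eps1 Q f (TensorAlgebra.ι C a * t)) =
      evaluation D I (φ (Q f) * nested I (letter φ) (TensorAlgebra.ι C a * t)) := by
  refine (SymmetricAlgebra.lift_ι_apply _ _).trans ?_
  simp [evalTensor, coe_posProj]

variable (hDI : ∀ x, D (I x) = x) (hI : ∀ c x, D c = 0 → I (c * x) = c * I x)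

include hDI in
lemma deriv_evalC1 (c : C1 Q) : D (evalC1 D I φ c) = 0 := by
  have h := deriv_lift_eq_zero (D := D) (evalTensor (Q := Q) D I φ)
    (fun _ => deriv_evaluation hDI _)
  exact h c

/-- The homomorphism out of `R ⊗ C̃₁ ⊗ (C₂ ⊗ T)` induced by `φ`. -/
def liftHom : IDRAlg Q →ₐ[C] S :=
  show R ⊗[C] (C1 Q ⊗[C] GenShuffle C (LinearMap.ker Q)) →ₐ[C] S from
    Algebra.TensorProduct.productMap φ
      (Algebra.TensorProduct.productMap (evalC1 D I φ) (genShuffleHom (letter φ) hDI hI))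

lemma liftHom_ofR (f : R) : liftHom (Q := Q) φ hDI hI (ofR Q f) = φ f :=
  Algebra.TensorProduct.productMap_left_apply _ _ f

lemma liftHom_ofC1 (c : C1 Q) : liftHom φ hDI hI (ofC1 Q c) = evalC1 D I φ c :=
  (Algebra.TensorProduct.productMap_right_apply _ _ _).trans
    (Algebra.TensorProduct.productMap_left_apply _ _ _)

lemma liftHom_ofGS (u : GenShuffle C (LinearMap.ker Q)) :
    liftHom φ hDI hI (ofGS Q u) = genShuffleLin (letter φ) hDI hI u :=
  (Algebra.TensorProduct.productMap_right_apply _ _ _).trans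
    (Algebra.TensorProduct.productMap_right_apply _ _ _)

lemma liftHom_ofT (t : TensorAlgebra C (LinearMap.ker Q)) :
    liftHom φ hDI hI (ofT Q t) = nested I (letter φ) t :=
  (liftHom_ofGS φ hDI hI _).trans (genShuffleLin_of _ _ _ _)

lemma liftHom_ofC2 (c : C2 C (LinearMap.ker Q)) :
    liftHom φ hDI hI (ofC2 Q c) = evalC2 (letter φ) hDI hI c := by
  have h : ofC2 Q c = ofGS Q (c • GenShuffle.of C _ 1) := by
    rw [← ofC2_mul_ofT, ofT_one, mul_one]
  rw [h, liftHom_ofGS, genShuffleLin_smul_of, nested_one, mul_one]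

variable (d : Derivation C R R) (hφ : ∀ f, φ (d f) = D (φ f))

/-- Differentiating a nested integral removes the outer integral and leaves the first letter as a
factor. -/
lemma liftHom_shift (t : TensorAlgebra C (LinearMap.ker Q)) :
    liftHom φ hDI hI (shift t) = D (nested I (letter φ) t) := by
  induction t using cons_induction with
  | one => rw [shift_one, map_zero, nested_one, D.map_one_eq_zero]
  | cons a t _ => rw [shift_cons, map_mul, liftHom_ofR, liftHom_ofT, nested_cons, hDI]; rfl
  | add x y hx hy => simp only [map_add, hx, hy]
  | smul c x hx => rw [map_smul, map_smul, map_smul, hx, D.map_smul]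

include hφ in
lemma liftHom_derivMap (x : IDRAlg Q) :
    liftHom φ hDI hI (derivMap Q d x) = D (liftHom φ hDI hI x) := by
  induction x using induction with
  | tens f c₁ c₂ t =>
    rw [derivMap_tens]
    simp only [map_mul, map_add, liftHom_ofR, liftHom_ofC1, liftHom_ofC2, liftHom_ofT,
      liftHom_shift, hφ, D.leibniz, deriv_evalC1 φ hDI, deriv_evalC2, smul_eq_mul]
    ring
  | add x y hx hy => simp only [map_add, hx, hy]

variable (hQ : ∀ f, Q (d (Q f)) = Q f) (hφQ : ∀ f, I (D (φ (Q f))) = φ (Q f))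

include hφ hφQ in
-- Integration by parts. With `N` the nested integral of a tensor `a ⊗ s`, `∫ (∂φ(Qf)) N` equals
-- `φ(Qf) N - E(φ(Qf) N) - ∫ φ(Qf) ∂N`, and `∂N` has a shorter tensor. The remaining part of `f`
-- lies in `R_T` and prepends a letter.
lemma liftHom_intCore (t : TensorAlgebra C (LinearMap.ker Q)) (f : R) :
    liftHom φ hDI hI (intCore d hQ t f) = I (φ f * nested I (letter φ) t) := by
  have hf : ∀ f, φ f = D (φ (Q f)) + letter φ (projT d hQ f) := fun f => by
    rw [← hφ, letter, LinearMap.comp_apply, Submodule.subtype_apply, coe_projT]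
    simp
  induction t using cons_induction generalizing f with
  | one =>
    -- For the empty tensor there is no boundary term, because `hφQ` says that `φ(Qf)` has
    -- evaluation zero.
    rw [intCore_one, map_add, liftHom_ofR, liftHom_ofT, nested_one, mul_one, hf f, map_add, hφQ,
      ← mul_one (TensorAlgebra.ι C _), nested_cons, nested_one, mul_one]
  | cons a t ih =>
    rw [intCore_cons, map_add, map_sub, map_sub, map_mul, liftHom_ofR, liftHom_ofT, liftHom_ofC1,
      liftHom_ofT, ih, evalC1_eps1_cons, nested_cons I _ (projT d hQ f), hf f, add_mul, map_add,
      evaluation_apply, D.leibniz, nested_cons, hDI, map_add, smul_eq_mul, smul_eq_mul, map_mul φ,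
      mul_comm _ (D _), mul_assoc (φ (Q f))]
    simp only [letter, LinearMap.comp_apply, Submodule.subtype_apply, AlgHom.toLinearMap_apply]
    ring
  | add x y hx hy => simp only [map_add, LinearMap.add_apply, mul_add, hx, hy]
  | smul c x hx => simp only [map_smul, LinearMap.smul_apply, mul_smul_comm, hx]

include hφ hφQ in
lemma liftHom_intMap (x : IDRAlg Q) :
    liftHom φ hDI hI (intMap d hQ x) = I (liftHom φ hDI hI x) := by
  induction x using induction with
  | tens f c₁ c₂ t =>
    rw [intMap_tens]
    simp only [map_mul, liftHom_ofR, liftHom_ofC1, liftHom_ofC2, liftHom_ofT,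
      liftHom_intCore φ hDI hI d hφ hQ hφQ]
    rw [mul_left_comm (φ f), mul_left_comm (φ f), hI _ _ (deriv_evalC1 φ hDI c₁),
      hI _ _ (deriv_evalC2 _ hDI hI c₂)]
  | add x y hx hy => simp only [map_add, hx, hy]

end existence

/-! ### Uniqueness: the values on `R` and the integration determine everything. -/

section uniqueness

variable (d : Derivation C R R) (hQ : ∀ f, Q (d (Q f)) = Q f)

/-- For `a` in `ker Q` the integration recursion collapses to its last term. This exhibits two terms
of the product recursion as integrals. -/
lemma ofGS_pre (a : LinearMap.ker Q) (u : GenShuffle C (LinearMap.ker Q)) :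
    ofGS Q (GenShuffle.pre a u) = intMap d hQ (ofR Q (a : R) * ofGS Q u) := by
  induction u using GenShuffle.induction with
  | smul_of e t =>
    rw [map_smul, GenShuffle.pre_of, ← ofC2_mul_ofT, ← ofC2_mul_ofT, mul_left_comm, intMap_ofC2_mul,
      intMap_ofR_ofT, intCore_of_ker]
  | add x y hx hy => simp only [map_add, mul_add, hx, hy]

/-- Every generator is reached: `Q` surjects onto its range, and `posProj` is the identity on `T̃`.
-/
lemma C1_algHom_ext {F G : C1 Q →ₐ[C] S} (h : ∀ f t, F (eps1 Q f t) = G (eps1 Q f t)) :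
    F = G := by
  refine SymmetricAlgebra.algHom_ext (TensorProduct.ext' fun f t => ?_)
  obtain ⟨f, rfl⟩ := LinearMap.surjective_rangeRestrict Q f
  have h := h f t
  rw [eps1, LinearMap.compr₂_apply, LinearMap.compl₁₂_apply, posProj_coe] at h
  exact h

lemma C2_algHom_ext {M : Type*} [AddCommGroup M] [Module C M] {F G : C2 C M →ₐ[C] S}
    (h : ∀ x y, F (eps C M x y) = G (eps C M x y)) : F = G := by
  have hFG : F.comp (toC2 C M) = G.comp (toC2 C M) := by
    refine SymmetricAlgebra.algHom_ext (LinearMap.ext fun n => ?_)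
    obtain ⟨n, rfl⟩ := Submodule.mkQ_surjective _ n
    have := LinearMap.congr_fun (TensorProduct.ext' (g :=
      (F.toLinearMap ∘ₗ (toC2 C M).toLinearMap ∘ₗ
        SymmetricAlgebra.ι C (SymSquare C (posPart C M))) ∘ₗ Submodule.mkQ _)
      (h := (G.toLinearMap ∘ₗ (toC2 C M).toLinearMap ∘ₗ
        SymmetricAlgebra.ι C (SymSquare C (posPart C M))) ∘ₗ Submodule.mkQ _) fun x y => by
        have h := h x y
        rw [eps, LinearMap.compr₂_apply, epsSym, LinearMap.compr₂_apply, LinearMap.compl₁₂_apply,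
          posProj_coe, posProj_coe] at h
        exact h) n
    exact this
  refine AlgHom.ext fun c => ?_
  obtain ⟨c, rfl⟩ := Ideal.Quotient.mk_surjective c
  exact DFunLike.congr_fun hFG c

/-- A homomorphism out of `R ⊗ C̃₁ ⊗ (C₂ ⊗ T)` that commutes with the integrations is determined by
its restriction to `R`. -/
theorem algHom_ext_of_intMap {F G : IDRAlg Q →ₐ[C] S}
    (hF : ∀ x, F (intMap d hQ x) = I (F x)) (hG : ∀ x, G (intMap d hQ x) = I (G x))
    (hR : ∀ f, F (ofR Q f) = G (ofR Q f)) : F = G := by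
  have hint : ∀ x, F x = G x → F (intMap d hQ x) = G (intMap d hQ x) := fun x hx => by
    rw [hF, hG, hx]
  have hT : ∀ t, F (ofT Q t) = G (ofT Q t) := by
    intro t
    induction t using cons_induction with
    | one => rw [ofT_one, map_one, map_one]
    | cons a t ih =>
      -- `a ⊗ t` is the integral of `a` times the shorter tensor `t`, since `a` lies in `ker Q`.
      rw [← intCore_of_ker d hQ, ← intMap_ofR_ofT]
      exact hint _ (by rw [map_mul, map_mul, hR, ih])
    | add x y hx hy => simp only [map_add, hx, hy]
    | smul c x hx => simp only [map_smul, hx]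
  have hcore : ∀ t f, F (intCore d hQ t f) = G (intCore d hQ t f) := fun t f => by
    rw [← intMap_ofR_ofT]
    exact hint _ (by rw [map_mul, map_mul, hR, hT])
  have hE1 : ∀ f t, F (ofC1 Q (eps1 Q f t)) = G (ofC1 Q (eps1 Q f t)) := by
    intro f t
    induction t using cons_induction with
    | one => rw [eps1_one, map_zero, map_zero, map_zero]
    | cons a t _ =>
      -- The integration recursion solved for its boundary term; all other terms are elements of
      -- `R`, tensors of `T`, or integrals of products of these.
      have h : ofC1 Q (eps1 Q f (TensorAlgebra.ι C a * t)) =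
          ofR Q (Q f) * ofT Q (TensorAlgebra.ι C a * t) - intCore d hQ t (Q f * a) +
            ofT Q (TensorAlgebra.ι C (projT d hQ f) * (TensorAlgebra.ι C a * t)) -
            intCore d hQ (TensorAlgebra.ι C a * t) f := by
        rw [intCore_cons]; ring
      rw [h]
      simp only [map_sub, map_add, map_mul F, map_mul G, hR, hT, hcore]
    | add x y hx hy => simp only [map_add, hx, hy]
    | smul c x hx => simp only [map_smul, hx]
  have hE2 : ∀ x y, F (ofC2 Q (eps C _ x y)) = G (ofC2 Q (eps C _ x y)) := by
    intro x y
    induction x using cons_induction with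
    | one => rw [GenShuffle.eps_one_left, map_zero, map_zero, map_zero]
    | cons a x ih =>
      clear ih
      induction y using cons_induction with
      | one => rw [GenShuffle.eps_one_right, map_zero, map_zero, map_zero]
      | cons b y _ =>
        -- The product recursion solved for `ε`: it is the product of two elements of `T` minus two
        -- integrals of products of known elements.
        have h := ofT_mul_ofT (TensorAlgebra.ι C a * x) (TensorAlgebra.ι C b * y)
        rw [GenShuffle.mulT_cons_cons, map_add, map_add, ofGS_pre d hQ, ofGS_pre d hQ,
          ← ofC2_mul_ofT, ofT_one, mul_one, ← ofT_mul_ofT, ← ofT_mul_ofT, GenShuffle.epsExt_apply,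
          aug_cons, map_zero, zero_mul, add_zero] at h
        rw [← sub_eq_iff_eq_add'.2 h]
        simp only [map_sub, map_add, map_mul F, map_mul G, hT, hF, hG, hR]
      | add x y hx hy => simp only [map_add, hx, hy]
      | smul c x hx => simp only [map_smul, hx]
    | add x y hx hy => simp only [map_add, LinearMap.add_apply, hx, hy]
    | smul c x hx => simp only [map_smul, LinearMap.smul_apply, hx]
  have hC1 : F.comp (ofC1 Q) = G.comp (ofC1 Q) := C1_algHom_ext hE1
  have hC2 : F.comp (ofC2 Q) = G.comp (ofC2 Q) := C2_algHom_ext hE2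
  ext x
  induction x using induction with
  | tens f c₁ c₂ t =>
    have h1 : F (ofC1 Q c₁) = G (ofC1 Q c₁) := DFunLike.congr_fun hC1 c₁
    have h2 : F (ofC2 Q c₂) = G (ofC2 Q c₂) := DFunLike.congr_fun hC2 c₂
    simp only [map_mul, hR, h1, h2, hT]
  | add x y hx hy => rw [map_add, map_add, hx, hy]

end uniqueness

end IDRAlg

end IntegroDiff

/-! ### Passage from algebras over the constants of `R` to rings. -/

set_option maxRecDepth 20000 in
lemma IDRQ.int_eq_intMap (R : Type*) [CommRing R] [QuasiIntegroDifferentialRing R] (x : IDRQ R) :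
    IntegroDifferentialRing.int x =
      IntegroDiff.IDRAlg.intMap (Q := QuasiIntegroDifferentialRing.Q (R := R))
        (derivOverConstants R) (IDRQ.Q_derivOverConstants_Q R) x := by
  rw [IDRQ.int_apply]
  unfold IDRQ.intFun
  rfl

/-- A differential ring homomorphism maps constants to constants. -/
lemma IsDifferentialHom.deriv_apply_eq_zero {R S : Type*} [CommRing R] [CommRing S]
    [Differential R] [Differential S] {φ : R →+* S} (hφ : IsDifferentialHom φ) {c : R}
    (hc : (c′) = 0) : (φ c)′ = 0 := by
  rw [← hφ, hc, map_zero]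

/-- The derivation of a ring whose derivation vanishes on the image of `C`, as a `C`-linear
derivation. -/
def derivOver (C : Type*) {S : Type*} [CommRing C] [CommRing S] [Differential S] [Algebra C S]
    (h : ∀ c : C, (algebraMap C S c)′ = 0) : Derivation C S S :=
  Derivation.mk'
    { toFun := fun f => (f′)
      map_add' := fun f g => map_add _ f g
      map_smul' := fun c f => by simp [Algebra.smul_def, h] }
    (fun f g => by simp)

/-- The integration of an integro-differential ring, linear over any `C` that acts by constants. -/
def intOver (C : Type*) {S : Type*} [CommRing C] [CommRing S] [IntegroDifferentialRing S]
    [Algebra C S] (h : ∀ c : C, (algebraMap C S c)′ = 0) : S →ₗ[C] S where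
  toFun := IntegroDifferentialRing.int
  map_add' := map_add _
  map_smul' c x := by
    rw [Algebra.smul_def, Algebra.smul_def]
    exact map_smul IntegroDifferentialRing.int (⟨algebraMap C S c, h c⟩ : constants S) x

end

theorem mainTheorem4 {R S : Type*} [CommRing R] [QuasiIntegroDifferentialRing R]
    [CommRing S] [IntegroDifferentialRing S] (φ : R →+* S) (hφ : IsDifferentialHom φ)
    (hφQ : ∀ f : R,
      φ (QuasiIntegroDifferentialRing.Q (f′)) = IntegroDifferentialRing.int ((φ f)′)) :
    ∃! η : IDRQ R →+* S,
      IsIntegroDifferentialHom η ∧ ∀ f : R, η (IDRQ.ι R f) = φ f := by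
  -- Since `φ` maps constants to constants, this structure makes both the derivation and the
  -- integration of `S` linear over the constants of `R`.
  let _ : Algebra (constants R) S := (φ.comp (constants R).subtype).toAlgebra
  have halg : ∀ c : constants R, (algebraMap (constants R) S c)′ = 0 := fun c =>
    hφ.deriv_apply_eq_zero c.2
  let Φ : R →ₐ[constants R] S := { φ with commutes' := fun _ => rfl }
  let D := derivOver (constants R) halg
  let I := intOver (constants R) halg
  have hDI : ∀ x, D (I x) = x := IntegroDifferentialRing.deriv_int
  have hI : ∀ c x, D c = 0 → I (c * x) = c * I x := fun c x hc =>
    map_smul IntegroDifferentialRing.int (⟨c, hc⟩ : constants S) x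
  have hΦ : ∀ f, Φ (derivOverConstants R f) = D (Φ f) := hφ
  -- The hypothesis on `φ` applied to `Q f`, combined with `Q∂Q = Q`.
  have hΦQ : ∀ f, I (D (Φ (QuasiIntegroDifferentialRing.Q f))) =
      Φ (QuasiIntegroDifferentialRing.Q f) := fun f =>
    (hφQ _).symm.trans (congrArg φ (QuasiIntegroDifferentialRing.Q_deriv_Q f))
  let η := IntegroDiff.IDRAlg.liftHom (Q := QuasiIntegroDifferentialRing.Q) Φ hDI hI
  have hη : ∀ x, η (IntegroDiff.IDRAlg.intMap (derivOverConstants R)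
      (IDRQ.Q_derivOverConstants_Q R) x) = I (η x) :=
    IntegroDiff.IDRAlg.liftHom_intMap Φ hDI hI (derivOverConstants R) hΦ _ hΦQ
  refine ⟨η.toRingHom, ⟨⟨?_, fun x => ?_⟩, ?_⟩, ?_⟩
  · exact IntegroDiff.IDRAlg.liftHom_derivMap Φ hDI hI (derivOverConstants R) hΦ
  · exact (congrArg η (IDRQ.int_eq_intMap R x)).trans (hη x)
  · exact IntegroDiff.IDRAlg.liftHom_ofR Φ hDI hI
  · rintro θ ⟨⟨-, hθ⟩, hθR⟩
    -- Agreement with `φ` on the constants of `R` makes a competing ring homomorphism an algebra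
    -- homomorphism.
    let Θ : IntegroDiff.IDRAlg (QuasiIntegroDifferentialRing.Q (R := R)) →ₐ[constants R] S :=
      { θ with
        commutes' := fun c => by
          rw [← (IntegroDiff.IDRAlg.ofR _).commutes]
          exact hθR c }
    have h : Θ = η := IntegroDiff.IDRAlg.algHom_ext_of_intMap (I := I) (derivOverConstants R)
      (IDRQ.Q_derivOverConstants_Q R)
      (fun x => (congrArg θ (IDRQ.int_eq_intMap R x)).symm.trans (hθ x)) hη fun f =>
        (hθR f).trans (IntegroDiff.IDRAlg.liftHom_ofR Φ hDI hI f).symm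
    exact congrArg AlgHom.toRingHom h
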